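/- **Definitions.** Let $P\subset\mathbb R^d$ be a $d$-polytope with labelled vertices $p_1,\dots,p_v$ and labelled facet inequalities $W_j\cdot x\le w_j$, $j=1,\dots,f$ (one for each facet). Its slack matrix $S_P\in\mathbb R^{v\times f}$ has entries $(S_P)_{ij}=w_j-W_j\cdot p_i$. The symbolic slack matrix $S_P(\mathbf x)$ is obtained from $S_P$ by replacing each nonzero entry by its own variable; let $x_1,\dots,x_t$ be these variables. The slack ideal of $P$ is $$I_P=\langle (d+2)\text{-minors of }S_P(\mathbf x)\rangle:\Big(\prod_{i=1}^t x_i\Big)^{\infty}\subset\mathbb C[x_1,\dots,x_t],$$ and the slack variety is its zero set $\mathcal V(I_P)\subset\mathbb C^t$. Two polytopes are in the same combinatorial class if there are bijections between their vertices and between their facets that preserve vertex–facet incidence. Let $\varphi=\frac{1+\sqrt5}{2}$ and consider the points of the plane $A=(-2\varphi,0)$, $B=(2\varphi+2,0)$, $C=(-\varphi,\varphi+1)$, $D=(\varphi+2,\varphi+1)$, $E=(0,0)$, $F=(2,0)$, $G=(1-\varphi,1)$, $H=(1+\varphi,1)$, $I=(1,\frac{5+\sqrt5}{10})$ (up to scaling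 the second coordinate, $E,F,H,G$ are four vertices of a regular pentagon, $A,B,C,D$ are four of the vertices of the pentagram obtained by extending its sides, and $I$ is its centre). Identify each point $(a,b)$ with the vector $(a,b,1)\in\mathbb R^3$. The Perles Gale diagram consists of the twelve vectors $A,B,C,D,E,F,G,H,-F,-G,-H,-I$, in this order. Vectors $g_1,\dots,g_n\in\mathbb R^m$ form a Gale diagram of points $p_1,\dots,p_n\in\mathbb R^d$ if there are $c_i>0$ such that the row space of the matrix with columns $c_ig_i$ equals $\{\lambda\in\mathbb R^n:\sum_i\lambda_i=0,\ \sum_i\lambda_ip_i=0\}$. **Theorem.** There are twelve points in $\mathbb R^8$ whose Gale diagram is the Perles Gale diagram. Any such points are the vertices of an 8-dimensional polytope with 12 vertices and 34 facets (the Perles polytope). Its facets can be ordered in such a way that the sets of vertices not lying on them are, with the vertices numbered $1,\dots,12$ as above, $\{6,9\}$, $\{7,10\}$, $\{8,11\}$, $\{1,2,9\}$, $\{1,4,10\}$, $\{1,8,12\}$, $\{2,3,11\}$, $\{2,5,9\}$, $\{2,7,12\}$, $\{3,5,10\}$, $\{3,6,12\}$, $\{4,5,12\}$, $\{4,6,11\}$,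 $\{1,2,3,10\}$, $\{1,2,3,12\}$, $\{1,2,4,11\}$, $\{1,2,4,12\}$, $\{1,3,6,10\}$, $\{1,3,8,10\}$, $\{1,4,6,12\}$, $\{1,8,9,10\}$, $\{2,3,5,12\}$, $\{2,4,5,11\}$, $\{2,4,7,11\}$, $\{2,7,9,11\}$, $\{3,5,8,12\}$, $\{3,6,10,11\}$, $\{4,5,9,10\}$, $\{4,5,10,11\}$, $\{4,6,7,12\}$, $\{5,7,8,12\}$, $\{5,8,9,10\}$, $\{5,8,9,12\}$, $\{6,7,8,12\}$. Let $P$ be this polytope or any 8-polytope in its combinatorial class, with its vertices and facets labelled correspondingly, and denote by $x_9,x_{10},x_{15},x_{16},x_{35},x_{36}$ the variables of $S_P(\mathbf x)$ in positions $(3,10),(3,11),(5,10),(5,12),(12,11),(12,12)$. Then the slack ideal $I_P$ is not prime, and neither is the vanishing ideal of the slack variety $\mathcal V(I_P)$. More precisely, the polynomial $$f=(x_{10}x_{15}x_{36})^2+(x_{10}x_{15}x_{36})(x_9x_{16}x_{35})-(x_9x_{16}x_{35})^2=(x_{10}x_{15}x_{36}-\alpha_1x_9x_{16}x_{35})(x_{10}x_{15}x_{36}-\alpha_2x_9x_{16}x_{35}),$$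 where $\alpha_{1}=\frac{-1+\sqrt5}{2}$ and $\alpha_{2}=\frac{-1-\sqrt5}{2}$, vanishes on $\mathcal V(I_P)$, but neither of its two factors vanishes identically on $\mathcal V(I_P)$. -/

import Mathlib

open MvPolynomial

/-! ### Polytopes with labelled vertices and facets, and their slack matrices -/

/-- A facet of a full-dimensional polytope in `ℝ^d`: a nonempty face (that is, a set on which some
linear functional attains its maximum over `P`) of dimension `d - 1`. -/
def IsFacet {d : ℕ} (P F : Set (Fin d → ℝ)) : Prop :=
  IsExposed ℝ P F ∧ F.Nonempty ∧ Module.finrank ℝ (vectorSpan ℝ F) + 1 = d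

/-- The points `p i` are the (distinct, labelled) vertices of a `d`-dimensional polytope
`P ⊂ ℝ^d` and the inequalities `W j ⬝ᵥ x ≤ w j` are its (labelled) facet inequalities:
they describe `P`, and each facet of `P` is cut out by exactly one of them. -/
structure IsLabelledPolytope {v f d : ℕ} (p : Fin v → Fin d → ℝ)
    (W : Matrix (Fin f) (Fin d) ℝ) (w : Fin f → ℝ) : Prop where
  full_dim : affineSpan ℝ (Set.range p) = ⊤
  vertex_injective : Function.Injective p
  vertices : Set.range p = (convexHull ℝ (Set.range p)).extremePoints ℝ
  halfspaces : convexHull ℝ (Set.range p) = {x | ∀ j, W j ⬝ᵥ x ≤ w j}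
  facets : Set.BijOn (fun j => {x ∈ convexHull ℝ (Set.range p) | W j ⬝ᵥ x = w j}) Set.univ
    {F | IsFacet (convexHull ℝ (Set.range p)) F}

/-- The slack matrix: entry `(i, j)` is the slack of vertex `i` in facet inequality `j`. -/
def slackMatrix {v f d : ℕ} (p : Fin v → Fin d → ℝ)
    (W : Matrix (Fin f) (Fin d) ℝ) (w : Fin f → ℝ) : Matrix (Fin v) (Fin f) ℝ :=
  Matrix.of fun i j => w j - W j ⬝ᵥ p i

/-! ### Slack ideals -/

/-- The saturation `I : g^∞` of an ideal with respect to an element. -/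
def idealSaturation {R : Type*} [CommRing R] (I : Ideal R) (g : R) : Ideal R where
  carrier := {h | ∃ n : ℕ, g ^ n * h ∈ I}
  zero_mem' := ⟨0, by simp⟩
  add_mem' := by
    rintro a b ⟨m, hm⟩ ⟨n, hn⟩
    refine ⟨m + n, ?_⟩
    have e : g ^ (m + n) * (a + b) = g ^ n * (g ^ m * a) + g ^ m * (g ^ n * b) := by ring
    rw [e]
    exact I.add_mem (I.mul_mem_left _ hm) (I.mul_mem_left _ hn)
  smul_mem' := by
    rintro c a ⟨n, hn⟩
    refine ⟨n, ?_⟩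
    have e : g ^ n * (c • a) = c * (g ^ n * a) := by rw [smul_eq_mul]; ring
    rw [e]
    exact I.mul_mem_left _ hn

/-- The ideal generated by the `k`-minors of a matrix. -/
def minorIdeal {R : Type*} [CommRing R] {v f : ℕ} (k : ℕ) (M : Matrix (Fin v) (Fin f) R) :
    Ideal R :=
  Ideal.span {m | ∃ (r : Fin k ↪o Fin v) (c : Fin k ↪o Fin f), m = (M.submatrix r c).det}

/-- The positions of the nonzero entries of a matrix; they index the variables of its symbolic
version. -/
abbrev SlackVar {v f : ℕ} (S : Matrix (Fin v) (Fin f) ℝ) : Type :=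
  {e : Fin v × Fin f // S e.1 e.2 ≠ 0}

open Classical in
/-- The symbolic slack matrix: each nonzero entry is replaced by its own variable. -/
noncomputable def symbolicSlackMatrix {v f : ℕ} (S : Matrix (Fin v) (Fin f) ℝ) :
    Matrix (Fin v) (Fin f) (MvPolynomial (SlackVar S) ℂ) :=
  Matrix.of fun i j => if h : S i j ≠ 0 then X ⟨(i, j), h⟩ else 0

open Classical in
/-- The slack ideal of a `d`-polytope with slack matrix `S`: the ideal of `(d+2)`-minors of the
symbolic slack matrix, saturated at the product of all the variables. -/
noncomputable def slackIdeal {v f : ℕ} (d : ℕ) (S : Matrix (Fin v) (Fin f) ℝ) :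
    Ideal (MvPolynomial (SlackVar S) ℂ) :=
  idealSaturation (minorIdeal (d + 2) (symbolicSlackMatrix S)) (∏ e : SlackVar S, X e)

/-- The slack variety: the complex zero set of the slack ideal. -/
noncomputable def slackVariety {v f : ℕ} (d : ℕ) (S : Matrix (Fin v) (Fin f) ℝ) :
    Set (SlackVar S → ℂ) :=
  zeroLocus ℂ (slackIdeal d S)

/-! ### Gale diagrams and the Perles configuration -/

/-- `g` is a Gale diagram of the points `p`: after multiplying the vectors `g i` by suitable
positive numbers `c i`, the row space of the matrix with columns `c i • g i` is the space of all
affine dependencies of the points `p i`. -/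
def HasGaleDiagram {n d m : ℕ} (p : Fin n → Fin d → ℝ) (g : Fin n → Fin m → ℝ) : Prop :=
  ∃ c : Fin n → ℝ, (∀ i, 0 < c i) ∧
    {l : Fin n → ℝ | ∑ i, l i = 0 ∧ ∑ i, l i • p i = 0} =
      {l : Fin n → ℝ | ∃ u : Fin m → ℝ, ∀ i, l i = u ⬝ᵥ (c i • g i)}

/-- The nine points `A, B, C, D, E, F, G, H, I` (in this order) of the Perles configuration. `E`,
`F`, `H`, `G` are four of the vertices of a regular pentagon, `A`, `B`, `C`, `D` are four of the
vertices of the pentagram obtained by extending its sides, and `I` is its centre. The first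
coordinate is the Euclidean one for side length `2`, the second one is the Euclidean one divided
by `2 sin 72°`. -/
noncomputable def perlesPoint : Fin 9 → Fin 2 → ℝ :=
  let φ : ℝ := (1 + √5) / 2
  ![![-2 * φ, 0], ![2 * φ + 2, 0], ![-φ, φ + 1], ![φ + 2, φ + 1],
    ![0, 0], ![2, 0], ![1 - φ, 1], ![1 + φ, 1], ![1, (5 + √5) / 10]]

/-- The vector in `ℝ³` at height one over a point of the plane. -/
def liftPoint (a : Fin 2 → ℝ) : Fin 3 → ℝ := ![a 0, a 1, 1]

/-- The twelve vectors `A, B, C, D, E, F, G, H, -F, -G, -H, -I` (in this order) of the Perles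
Gale diagram. -/
noncomputable def perlesGale : Fin 12 → Fin 3 → ℝ :=
  let g : Fin 9 → Fin 3 → ℝ := fun i => liftPoint (perlesPoint i)
  ![g 0, g 1, g 2, g 3, g 4, g 5, g 6, g 7, -g 5, -g 6, -g 7, -g 8]

/-- The `34` columns of the support of the Perles slack matrix: the `j`-th entry is the set of
(indices of) vertices that do not lie on the `j`-th facet. -/
def perlesCofacet : Fin 34 → Finset (Fin 12) :=
  ![
    {5, 8}, {6, 9}, {7, 10}, {0, 1, 8}, {0, 3, 9},
    {0, 7, 11}, {1, 2, 10}, {1, 4, 8}, {1, 6, 11}, {2, 4, 9},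
    {2, 5, 11}, {3, 4, 11}, {3, 5, 10}, {0, 1, 2, 9}, {0, 1, 2, 11},
    {0, 1, 3, 10}, {0, 1, 3, 11}, {0, 2, 5, 9}, {0, 2, 7, 9}, {0, 3, 5, 11},
    {0, 7, 8, 9}, {1, 2, 4, 11}, {1, 3, 4, 10}, {1, 3, 6, 10}, {1, 6, 8, 10},
    {2, 4, 7, 11}, {2, 5, 9, 10}, {3, 4, 8, 9}, {3, 4, 9, 10}, {3, 5, 6, 11},
    {4, 6, 7, 11}, {4, 7, 8, 9}, {4, 7, 8, 11}, {5, 6, 7, 11}]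

/-!
The supports of the facets of a polytope are those of the positive circuits of a Gale diagram. For
the Perles configuration, the polytope and its facets are obtained from linear duality
(`exists_isLabelledPolytope_of_gale`): the affine functions that are nonnegative on the points
correspond to the nonnegative dependencies of the Gale vectors, and these are nonnegative
combinations of circuits. It has to be checked that the support of every nonnegative dependency
contains one of the 34 cofacets. This holds because every other set of Gale vectors lies in an
open half-space; the half-spaces and the coefficients of the circuits are listed over `ℤ[√5]`, so
that the verification is a finite computation (`exists_perlesCofacet_subset_or`).

A `12 × 34` matrix of rank at most nine with the support of the Perles slack matrix has a left
kernel of dimension three; a basis of it gives twelve vectors in `ℂ³` that satisfy the incidences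
of the Perles configuration. These incidences fix the configuration up to projective transformations and
the choice of a root of a quadratic polynomial, which is expressed in the entries of the matrix by
the relation `f = 0` (`perles_relation`). Together with the Nullstellensatz this shows that a power
of `f` lies in the slack ideal (`exists_pow_mem_slackIdeal`).

The circuits over `ℤ[√5]` define, for each of the two square roots of five, a point of the slack
variety (`exists_mem_slackVariety_perles`). At each of the two points only one of the factors of
`f` vanishes, so neither factor vanishes on the variety and neither ideal is prime. Only the support
of the slack matrix matters, so the result holds for the whole combinatorial class.
-/

/-! ### Rank and minors -/

theorem exists_orderEmbedding_linearIndependent {K V : Type*} [Field K] [AddCommGroup V]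
    [Module K V] {m k : ℕ} (v : Fin m → V)
    (h : k ≤ Module.finrank K (Submodule.span K (Set.range v))) :
    ∃ r : Fin k ↪o Fin m, LinearIndependent K (v ∘ r) := by
  classical
  obtain ⟨κ, a, ha, hspan, hli⟩ := exists_linearIndependent' K v
  have : Finite κ := Finite.of_injective a ha
  have := Fintype.ofFinite κ
  rw [← hspan, finrank_span_eq_card hli] at h
  have hcard : k ≤ (Finset.univ.image a).card := by
    rwa [Finset.card_image_of_injective _ ha, Finset.card_univ]
  obtain ⟨t, ht, htk⟩ := Finset.exists_subset_card_eq hcard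
  have hmem : ∀ i, ∃ x, a x = t.orderEmbOfFin htk i := fun i => by
    simpa using ht (t.orderEmbOfFin_mem htk i)
  choose b hb using hmem
  refine ⟨t.orderEmbOfFin htk, ?_⟩
  have hbi : Function.Injective b := fun i j hij => (t.orderEmbOfFin htk).injective (by
    rw [← hb, ← hb, hij])
  have := hli.comp b hbi
  convert this using 1
  funext i
  simp [hb]

/-- The rank of a matrix is at most `k` if and only if all its `(k + 1)`-minors vanish. -/
theorem Matrix.rank_le_iff_forall_minor_eq_zero {K : Type*} [Field K] {m n k : ℕ}
    (A : Matrix (Fin m) (Fin n) K) :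
    A.rank ≤ k ↔ ∀ (r : Fin (k + 1) ↪o Fin m) (c : Fin (k + 1) ↪o Fin n),
      (A.submatrix r c).det = 0 := by
  constructor
  · intro h r c
    by_contra hdet
    have h1 := Matrix.rank_of_det_ne_zero hdet
    have h2 := Matrix.rank_submatrix_le A r c
    simp at h1
    omega
  · intro h
    by_contra! hk
    rw [Matrix.rank_eq_finrank_span_row] at hk
    obtain ⟨r, hr⟩ := exists_orderEmbedding_linearIndependent A.row (k := k + 1) hk
    have hrank : (A.submatrix r id).rank = k + 1 := by
      simpa using LinearIndependent.rank_matrix (M := A.submatrix r id) hr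
    rw [Matrix.rank_eq_finrank_span_cols] at hrank
    obtain ⟨c, hc⟩ := exists_orderEmbedding_linearIndependent (A.submatrix r id).col hrank.ge
    have hunit := (Matrix.linearIndependent_cols_iff_isUnit (A := A.submatrix r c)).1 hc
    rw [Matrix.isUnit_iff_isUnit_det] at hunit
    exact hunit.ne_zero (h r c)

/-! ### Facets from slack columns -/

theorem exists_dotProduct_eq {d : ℕ} (φ : (Fin d → ℝ) →ₗ[ℝ] ℝ) :
    ∃ a : Fin d → ℝ, ∀ x, φ x = a ⬝ᵥ x :=
  ⟨(dotProductEquiv ℝ (Fin d)).symm φ, fun x => by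
    rw [← dotProductEquiv_apply_apply, LinearEquiv.apply_symm_apply]⟩

/-- If no nonzero linear functional is constant on a family of points, the family spans the
space affinely. -/
theorem affineSpan_range_eq_top_of_dotProduct {n d : ℕ} [Nonempty (Fin n)]
    {p : Fin n → Fin d → ℝ} (h : ∀ (a : Fin d → ℝ) (b : ℝ), (∀ i, a ⬝ᵥ p i = b) → a = 0) :
    affineSpan ℝ (Set.range p) = ⊤ := by
  rw [AffineSubspace.affineSpan_eq_top_iff_vectorSpan_eq_top_of_nonempty ℝ _ _
    (Set.range_nonempty p)]
  by_contra hne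
  obtain ⟨φ, hφ, hker⟩ := Submodule.exists_le_ker_of_lt_top _ (lt_top_iff_ne_top.2 hne)
  obtain ⟨a, ha⟩ := exists_dotProduct_eq φ
  have i₀ : Fin n := Classical.arbitrary _
  apply hφ
  have ha0 : a = 0 := by
    refine h a (a ⬝ᵥ p i₀) fun i => ?_
    have := hker (vsub_mem_vectorSpan ℝ (Set.mem_range_self i) (Set.mem_range_self i₀))
    rw [LinearMap.mem_ker, vsub_eq_sub, ha, dotProduct_sub] at this
    linarith
  refine LinearMap.ext fun x => ?_
  simp [ha, ha0]

theorem convex_setOf_dotProduct_le {d : ℕ} (a : Fin d → ℝ) (b : ℝ) :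
    Convex ℝ {x : Fin d → ℝ | a ⬝ᵥ x ≤ b} :=
  convex_halfSpace_le (dotProductEquiv ℝ (Fin d) a).isLinear b

theorem dotProduct_le_of_mem_convexHull {n d : ℕ} {p : Fin n → Fin d → ℝ} {a : Fin d → ℝ} {b : ℝ}
    (h : ∀ i, a ⬝ᵥ p i ≤ b) {x : Fin d → ℝ} (hx : x ∈ convexHull ℝ (Set.range p)) :
    a ⬝ᵥ x ≤ b :=
  convexHull_min (by rintro _ ⟨i, rfl⟩; exact h i) (convex_setOf_dotProduct_le a b) hx

section Criterion

variable {n f d : ℕ} {p : Fin n → Fin d → ℝ} {W : Matrix (Fin f) (Fin d) ℝ} {w : Fin f → ℝ}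

/-- If no nonzero linear functional is constant on the points `p i`, a combination of slack columns
that represents an inequality on the points represents it everywhere. -/
theorem slack_combination_eq (hinj : ∀ (a : Fin d → ℝ) (b : ℝ), (∀ i, a ⬝ᵥ p i = b) → a = 0)
    [Nonempty (Fin n)] {a : Fin d → ℝ} {b : ℝ} {t : Fin f → ℝ}
    (ht : ∀ i, b - a ⬝ᵥ p i = ∑ j, t j * slackMatrix p W w i j) (x : Fin d → ℝ) :
    b - a ⬝ᵥ x = ∑ j, t j * (w j - W j ⬝ᵥ x) := by
  have key : ∀ x, ∑ j, t j * (w j - W j ⬝ᵥ x) = (∑ j, t j * w j) - (∑ j, t j • W j) ⬝ᵥ x := by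
    intro x
    rw [sum_dotProduct, ← Finset.sum_sub_distrib]
    refine Finset.sum_congr rfl fun j _ => ?_
    rw [smul_dotProduct, smul_eq_mul, mul_sub]
  have h0 : ∀ i, (a - ∑ j, t j • W j) ⬝ᵥ p i = b - ∑ j, t j * w j := by
    intro i
    have h1 := ht i
    simp only [slackMatrix, Matrix.of_apply] at h1
    rw [key] at h1
    rw [sub_dotProduct]
    linarith
  have ha := hinj _ _ h0
  have hb := h0 (Classical.arbitrary _)
  rw [ha, zero_dotProduct] at hb
  rw [sub_eq_zero] at ha
  rw [key, ← ha]
  linarith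

theorem finrank_ker_dotProduct {a : Fin d → ℝ} (ha : a ≠ 0) :
    Module.finrank ℝ (LinearMap.ker (dotProductEquiv ℝ (Fin d) a)) + 1 = d := by
  have h := Module.Dual.finrank_ker_add_one_of_ne_zero (f := dotProductEquiv ℝ (Fin d) a)
    (by simpa using ha)
  simpa using h

/-- If all linear functionals that are constant on a set are multiples of a given one, the direction
of the affine span of the set is the kernel of that functional. -/
theorem vectorSpan_eq_ker_dotProduct {s : Set (Fin d → ℝ)} {c : Fin d → ℝ} {e : ℝ}
    (hs : s.Nonempty) (hc : ∀ x ∈ s, c ⬝ᵥ x = e)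
    (h : ∀ (a : Fin d → ℝ) (b : ℝ), (∀ x ∈ s, a ⬝ᵥ x = b) → ∃ t : ℝ, a = t • c) :
    vectorSpan ℝ s = LinearMap.ker (dotProductEquiv ℝ (Fin d) c) := by
  apply le_antisymm
  · rw [vectorSpan, Submodule.span_le]
    rintro _ ⟨x, hx, y, hy, rfl⟩
    simp [hc x hx, hc y hy, dotProduct_sub]
  · intro v hv
    by_contra hvs
    obtain ⟨φ, hφ, hker⟩ := Submodule.exists_le_ker_of_notMem hvs
    obtain ⟨a, ha⟩ := exists_dotProduct_eq φ
    obtain ⟨x₀, hx₀⟩ := hs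
    obtain ⟨t, ht⟩ := h a (a ⬝ᵥ x₀) fun x hx => by
      have := hker (vsub_mem_vectorSpan ℝ hx hx₀)
      rw [LinearMap.mem_ker, vsub_eq_sub, ha, dotProduct_sub] at this
      linarith
    apply hφ
    rw [LinearMap.mem_ker, dotProductEquiv_apply_apply] at hv
    rw [ha, ht, smul_dotProduct, hv, smul_zero]

/-- A criterion for inequalities to be the facet inequalities of the convex hull of points that
span the space affinely. In terms of the slack columns: every inequality valid on the points is a
nonnegative combination of the given ones, the inequalities that are tight where a given one is are
its multiples, and the supports separate the columns as well as the rows. -/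
theorem isLabelledPolytope_of_slackMatrix [Nonempty (Fin n)]
    (hinj : ∀ (a : Fin d → ℝ) (b : ℝ), (∀ i, a ⬝ᵥ p i = b) → a = 0)
    (hpos : ∀ i j, 0 ≤ slackMatrix p W w i j)
    (hgen : ∀ (a : Fin d → ℝ) (b : ℝ), (∀ i, a ⬝ᵥ p i ≤ b) → ∃ t : Fin f → ℝ, (∀ j, 0 ≤ t j) ∧
      ∀ i, b - a ⬝ᵥ p i = ∑ j, t j * slackMatrix p W w i j)
    (hfac : ∀ (j : Fin f) (a : Fin d → ℝ) (b : ℝ),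
      (∀ i, slackMatrix p W w i j = 0 → a ⬝ᵥ p i = b) →
      ∃ t : ℝ, ∀ i, b - a ⬝ᵥ p i = t * slackMatrix p W w i j)
    (hzero : ∀ j, ∃ i, slackMatrix p W w i j = 0)
    (hnz : ∀ j, ∃ i, slackMatrix p W w i j ≠ 0)
    (hcols : ∀ j k, (∀ i, slackMatrix p W w i j = 0 ↔ slackMatrix p W w i k = 0) → j = k)
    (hrows : ∀ i k, i ≠ k → ∃ j, slackMatrix p W w i j = 0 ∧ slackMatrix p W w k j ≠ 0) :
    IsLabelledPolytope p W w := by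
  have hslack : ∀ i j, slackMatrix p W w i j = w j - W j ⬝ᵥ p i := fun i j => rfl
  have hle : ∀ x ∈ convexHull ℝ (Set.range p), ∀ j, W j ⬝ᵥ x ≤ w j := fun x hx j =>
    dotProduct_le_of_mem_convexHull (fun i => by have := hpos i j; rw [hslack] at this; linarith) hx
  have hp : ∀ i, p i ∈ convexHull ℝ (Set.range p) := fun i =>
    subset_convexHull ℝ _ (Set.mem_range_self i)
  have hcompact : IsCompact (convexHull ℝ (Set.range p)) :=
    (Set.finite_range p).isCompact_convexHull ℝ
  -- the direction of each face cut out by one of the inequalities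
  have hdir : ∀ j, vectorSpan ℝ {x ∈ convexHull ℝ (Set.range p) | W j ⬝ᵥ x = w j} =
      LinearMap.ker (dotProductEquiv ℝ (Fin d) (W j)) := by
    intro j
    obtain ⟨i₀, hi₀⟩ := hzero j
    refine vectorSpan_eq_ker_dotProduct ⟨p i₀, hp i₀, ?_⟩ (fun x hx => hx.2) ?_
    · rw [hslack] at hi₀; linarith
    · intro a b hab
      obtain ⟨t, ht⟩ := hfac j a b fun i hi => hab _ ⟨hp i, by rw [hslack] at hi; linarith⟩
      refine ⟨t, sub_eq_zero.1 (hinj _ (b - t * w j) fun i => ?_)⟩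
      have := ht i
      rw [hslack] at this
      rw [sub_dotProduct, smul_dotProduct, smul_eq_mul]
      linarith
  have hW0 : ∀ j, W j ≠ 0 := by
    intro j h0
    obtain ⟨i, hi⟩ := hzero j
    obtain ⟨k, hk⟩ := hnz j
    rw [hslack, h0, zero_dotProduct] at hi hk
    exact hk hi
  have hfacet : ∀ j, IsFacet (convexHull ℝ (Set.range p))
      {x ∈ convexHull ℝ (Set.range p) | W j ⬝ᵥ x = w j} := by
    intro j
    obtain ⟨i₀, hi₀⟩ := hzero j
    rw [hslack, sub_eq_zero] at hi₀
    refine ⟨fun _ => ⟨LinearMap.toContinuousLinearMap (dotProductEquiv ℝ (Fin d) (W j)), ?_⟩,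
      ⟨p i₀, hp i₀, hi₀.symm⟩, ?_⟩
    · ext x
      simp only [Set.mem_ofPred_eq, LinearMap.coe_toContinuousLinearMap', dotProductEquiv_apply_apply]
      refine and_congr_right fun hx => ⟨fun h y hy => h ▸ hle y hy j, fun h => ?_⟩
      exact le_antisymm (hle x hx j) (hi₀ ▸ h _ (hp i₀))
    · rw [hdir, finrank_ker_dotProduct (hW0 j)]
  have hpinj : Function.Injective p := by
    intro i k hik
    by_contra hne
    obtain ⟨j, h1, h2⟩ := hrows i k hne
    rw [hslack, hik] at h1
    exact h2 h1
  refine ⟨affineSpan_range_eq_top_of_dotProduct hinj, hpinj, ?_, ?_, ?_, ?_, ?_⟩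
  · refine Set.Subset.antisymm ?_ extremePoints_convexHull_subset
    rintro _ ⟨i, rfl⟩
    by_contra hext
    -- by Krein-Milman the other vertices would generate the polytope, although they lie strictly
    -- on one side of a supporting hyperplane at `p i`
    let s : (Fin d → ℝ) → ℝ := fun x =>
      ∑ j with slackMatrix p W w i j = 0, (w j - W j ⬝ᵥ x)
    have hs0 : s (p i) = 0 := Finset.sum_eq_zero fun j hj => by simpa [hslack] using hj
    have hspos : ∀ k, k ≠ i → 0 < s (p k) := by
      intro k hk
      obtain ⟨j, h1, h2⟩ := hrows i k hk.symm
      exact Finset.sum_pos' (fun j _ => hpos k j)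
        ⟨j, by simpa using h1, lt_of_le_of_ne (hpos k j) h2.symm⟩
    have hconv : Convex ℝ {x | 0 < s x} := by
      intro x hx y hy α β hα hβ hαβ
      have : s (α • x + β • y) = α * s x + β * s y := by
        simp only [s, Finset.mul_sum, ← Finset.sum_add_distrib]
        refine Finset.sum_congr rfl fun j _ => ?_
        rw [dotProduct_add, dotProduct_smul, dotProduct_smul, smul_eq_mul, smul_eq_mul]
        linear_combination (-w j) * hαβ
      rw [Set.mem_ofPred_eq, this]
      rcases hα.eq_or_lt with rfl | hα
      · rw [zero_add] at hαβ; simpa [hαβ] using hy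
      · exact add_pos_of_pos_of_nonneg (mul_pos hα hx) (mul_nonneg hβ hy.le)
    have hsub : (convexHull ℝ (Set.range p)).extremePoints ℝ ⊆ {x | 0 < s x} := by
      intro x hx
      obtain ⟨k, rfl⟩ := extremePoints_convexHull_subset hx
      exact hspos k fun hk => hext (hk ▸ hx)
    have hclosed : IsClosed (convexHull ℝ ((convexHull ℝ (Set.range p)).extremePoints ℝ)) :=
      ((Set.finite_range p).subset extremePoints_convexHull_subset).isClosed_convexHull ℝ
    have hKM := closure_convexHull_extremePoints hcompact (convex_convexHull ℝ (Set.range p))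
    rw [hclosed.closure_eq] at hKM
    have hmem := convexHull_min hsub hconv (hKM ▸ hp i)
    rw [Set.mem_ofPred_eq, hs0] at hmem
    exact lt_irrefl _ hmem
  · refine Set.Subset.antisymm hle fun x hx => ?_
    by_contra hxn
    obtain ⟨φ, u, hφ, hux⟩ := geometric_hahn_banach_closed_point
      (convex_convexHull ℝ (Set.range p)) hcompact.isClosed hxn
    obtain ⟨a, ha⟩ := exists_dotProduct_eq φ.toLinearMap
    change ∀ x, φ x = a ⬝ᵥ x at ha
    obtain ⟨t, ht0, ht⟩ := hgen a u fun i => by rw [← ha]; exact (hφ _ (hp i)).le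
    have := slack_combination_eq hinj ht x
    have hnn : 0 ≤ ∑ j, t j * (w j - W j ⬝ᵥ x) :=
      Finset.sum_nonneg fun j _ => mul_nonneg (ht0 j) (sub_nonneg.2 (hx j))
    rw [ha] at hux
    linarith
  · exact fun j _ => hfacet j
  · intro j _ k _ hjk
    refine hcols j k fun i => ?_
    have : p i ∈ {x ∈ convexHull ℝ (Set.range p) | W j ⬝ᵥ x = w j} ↔
        p i ∈ {x ∈ convexHull ℝ (Set.range p) | W k ⬝ᵥ x = w k} := by
      simp only at hjk
      rw [hjk]
    simpa [hp i, hslack, sub_eq_zero, eq_comm] using this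
  · rintro F ⟨hexp, hFne, hdim⟩
    obtain ⟨φ, hF⟩ := hexp hFne
    obtain ⟨a, ha⟩ := exists_dotProduct_eq φ.toLinearMap
    change ∀ x, φ x = a ⬝ᵥ x at ha
    obtain rfl : F = {x ∈ convexHull ℝ (Set.range p) | ∀ y ∈ convexHull ℝ (Set.range p),
        a ⬝ᵥ y ≤ a ⬝ᵥ x} := by simpa only [ha] using hF
    obtain ⟨x₀, hx₀, hmax⟩ := hFne
    obtain ⟨t, ht0, ht⟩ := hgen a (a ⬝ᵥ x₀) fun i => hmax _ (hp i)
    have hx := slack_combination_eq hinj ht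
    have hj : ∃ j, t j ≠ 0 := by
      by_contra! h0
      simp only [h0, zero_mul, Finset.sum_const_zero] at hx
      have hall : {x ∈ convexHull ℝ (Set.range p) | ∀ y ∈ convexHull ℝ (Set.range p),
          a ⬝ᵥ y ≤ a ⬝ᵥ x} = convexHull ℝ (Set.range p) := by
        refine Set.Subset.antisymm (fun x hx => hx.1) fun x hx' => ⟨hx', fun y _ => ?_⟩
        linarith [hx x, hx y]
      rw [hall, ← direction_affineSpan, affineSpan_convexHull,
        affineSpan_range_eq_top_of_dotProduct hinj, AffineSubspace.direction_top, finrank_top,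
        Module.finrank_fin_fun] at hdim
      omega
    obtain ⟨j, hj⟩ := hj
    refine ⟨j, Set.mem_univ _, ?_⟩
    -- the facet lies in the face of the `j`-th inequality, and both have the same direction
    have hsub : {x ∈ convexHull ℝ (Set.range p) | ∀ y ∈ convexHull ℝ (Set.range p),
        a ⬝ᵥ y ≤ a ⬝ᵥ x} ⊆ {x ∈ convexHull ℝ (Set.range p) | W j ⬝ᵥ x = w j} := by
      rintro x ⟨hxP, hxmax⟩
      refine ⟨hxP, ?_⟩
      have h0 : ∑ j, t j * (w j - W j ⬝ᵥ x) = 0 := by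
        rw [← hx, sub_eq_zero]
        exact le_antisymm (hxmax _ hx₀) (hmax _ hxP)
      rw [Finset.sum_eq_zero_iff_of_nonneg
        fun k _ => mul_nonneg (ht0 k) (sub_nonneg.2 (hle x hxP k))] at h0
      have := (mul_eq_zero.1 (h0 j (Finset.mem_univ _))).resolve_left hj
      linarith
    have hspan := Submodule.eq_of_le_of_finrank_eq (vectorSpan_mono ℝ hsub) (by
      have := (hfacet j).2.2
      omega)
    refine Set.Subset.antisymm (fun x hxj => ⟨hxj.1, fun y hy => ?_⟩) hsub
    have hv : x - x₀ ∈ vectorSpan ℝ {x ∈ convexHull ℝ (Set.range p) |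
        ∀ y ∈ convexHull ℝ (Set.range p), a ⬝ᵥ y ≤ a ⬝ᵥ x} := by
      rw [hspan]
      exact vsub_mem_vectorSpan ℝ hxj (hsub ⟨hx₀, hmax⟩)
    have hle' : vectorSpan ℝ {x ∈ convexHull ℝ (Set.range p) |
        ∀ y ∈ convexHull ℝ (Set.range p), a ⬝ᵥ y ≤ a ⬝ᵥ x} ≤
        LinearMap.ker (dotProductEquiv ℝ (Fin d) a) := by
      rw [vectorSpan, Submodule.span_le]
      rintro _ ⟨x, hx, y, hy, rfl⟩
      simp [dotProduct_sub, le_antisymm (hx.2 _ hy.1) (hy.2 _ hx.1)]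
    have h0 := hle' hv
    rw [LinearMap.mem_ker, dotProductEquiv_apply_apply, dotProduct_sub, sub_eq_zero] at h0
    exact h0 ▸ hmax y hy

end Criterion

/-- Subtracting the largest admissible multiple of a column: the result is nonnegative on the
support of the column, and vanishes somewhere on it. -/
theorem exists_sub_smul_nonneg {ι : Type*} [Fintype ι] {m s : ι → ℝ} (hm : ∀ i, 0 ≤ m i)
    (hne : ∃ i, m i ≠ 0) :
    ∃ t : ℝ, (∀ i, m i ≠ 0 → 0 ≤ s i - t * m i) ∧ (∃ i, m i ≠ 0 ∧ s i - t * m i = 0) ∧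
      ((∀ i, 0 ≤ s i) → 0 ≤ t) := by
  classical
  obtain ⟨i₁, hi₁⟩ := hne
  obtain ⟨i₀, hi₀, hmin⟩ := Finset.exists_min_image (Finset.univ.filter fun i => m i ≠ 0)
    (fun i => s i / m i) ⟨i₁, by simpa using hi₁⟩
  have hi₀ : m i₀ ≠ 0 := by simpa using hi₀
  refine ⟨s i₀ / m i₀, fun i hi => ?_, ⟨i₀, hi₀, by field_simp; ring⟩,
    fun h => div_nonneg (h _) (hm _)⟩
  have h1 := hmin i (by simpa using hi)
  have h2 : 0 < m i := lt_of_le_of_ne (hm i) hi.symm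
  rw [le_div_iff₀ h2] at h1
  linarith

/-- If every nonzero nonnegative vector of a subspace contains the support of one of the given
nonnegative vectors of the subspace in its support, these vectors generate the cone of nonnegative
vectors of the subspace. -/
theorem exists_nonneg_combination {n f : ℕ} {K : Submodule ℝ (Fin n → ℝ)}
    {M : Matrix (Fin n) (Fin f) ℝ} (hM : ∀ i j, 0 ≤ M i j) (hne : ∀ j, ∃ i, M i j ≠ 0)
    (hK : ∀ j, (fun i => M i j) ∈ K)
    (hsupp : ∀ s ∈ K, (∀ i, 0 ≤ s i) → s ≠ 0 → ∃ j, ∀ i, M i j ≠ 0 → s i ≠ 0) :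
    ∀ s ∈ K, (∀ i, 0 ≤ s i) → ∃ t : Fin f → ℝ, (∀ j, 0 ≤ t j) ∧ ∀ i, s i = ∑ j, t j * M i j := by
  classical
  suffices H : ∀ (N : ℕ) (s : Fin n → ℝ), s ∈ K → (∀ i, 0 ≤ s i) →
      (Finset.univ.filter fun i => s i ≠ 0).card ≤ N →
      ∃ t : Fin f → ℝ, (∀ j, 0 ≤ t j) ∧ ∀ i, s i = ∑ j, t j * M i j from
    fun s hs h0 => H _ s hs h0 le_rfl
  intro N
  induction N with
  | zero =>
    intro s _ _ hc
    refine ⟨0, fun _ => le_rfl, fun i => ?_⟩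
    simp only [nonpos_iff_eq_zero, Finset.card_eq_zero, Finset.filter_eq_empty_iff] at hc
    simpa using hc (Finset.mem_univ i)
  | succ N ih =>
    intro s hs h0 hc
    by_cases hs0 : s = 0
    · exact ⟨0, fun _ => le_rfl, fun i => by simp [hs0]⟩
    obtain ⟨j, hj⟩ := hsupp s hs h0 hs0
    obtain ⟨t, ht, ⟨i₀, hi₀, hti₀⟩, htn⟩ := exists_sub_smul_nonneg (s := s) (fun i => hM i j) (hne j)
    have hs' : s - t • (fun i => M i j) ∈ K := K.sub_mem hs (K.smul_mem _ (hK j))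
    have hn' : ∀ i, 0 ≤ (s - t • (fun i => M i j)) i := by
      intro i
      by_cases hi : M i j = 0
      · simpa [hi] using h0 i
      · simpa using ht i hi
    have hc' : (Finset.univ.filter fun i => (s - t • (fun i => M i j)) i ≠ 0).card ≤ N := by
      refine Nat.lt_succ_iff.1 (lt_of_lt_of_le (Finset.card_lt_card ?_) hc)
      rw [Finset.ssubset_iff_of_subset]
      · exact ⟨i₀, by simpa using hj i₀ hi₀, by simpa using hti₀⟩
      · intro i hi
        rw [Finset.mem_filter] at hi ⊢
        refine ⟨hi.1, fun h => hi.2 ?_⟩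
        have : M i j = 0 := by
          by_contra hm
          exact hj i hm h
        simp [h, this]
    obtain ⟨t', ht'0, ht'⟩ := ih _ hs' hn' hc'
    refine ⟨t' + Pi.single j t, fun k => add_nonneg (ht'0 k) ?_, fun i => ?_⟩
    · rcases eq_or_ne k j with rfl | hk
      · simpa using htn h0
      · simp [hk]
    · have := ht' i
      simp only [Pi.sub_apply, Pi.smul_apply, smul_eq_mul] at this
      simp only [Pi.add_apply, add_mul, Finset.sum_add_distrib, ← this, Pi.single_apply, ite_mul,
        zero_mul, Finset.sum_ite_eq', Finset.mem_univ, if_true]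
      ring

/-- In the situation of `exists_nonneg_combination`, if no support contains another one, each of
the given vectors is determined by its support up to a factor. -/
theorem exists_eq_mul_of_support_subset {n f : ℕ} {K : Submodule ℝ (Fin n → ℝ)}
    {M : Matrix (Fin n) (Fin f) ℝ} (hM : ∀ i j, 0 ≤ M i j) (hne : ∀ j, ∃ i, M i j ≠ 0)
    (hK : ∀ j, (fun i => M i j) ∈ K)
    (hsupp : ∀ s ∈ K, (∀ i, 0 ≤ s i) → s ≠ 0 → ∃ j, ∀ i, M i j ≠ 0 → s i ≠ 0)
    (hanti : ∀ j k, (∀ i, M i k ≠ 0 → M i j ≠ 0) → k = j) (j : Fin f) {s : Fin n → ℝ}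
    (hs : s ∈ K) (hsj : ∀ i, M i j = 0 → s i = 0) : ∃ t : ℝ, ∀ i, s i = t * M i j := by
  obtain ⟨t, ht, ⟨i₀, hi₀, hti₀⟩, -⟩ := exists_sub_smul_nonneg (s := s) (fun i => hM i j) (hne j)
  refine ⟨t, fun i => ?_⟩
  have hs' : s - t • (fun i => M i j) ∈ K := K.sub_mem hs (K.smul_mem _ (hK j))
  by_contra hi
  obtain ⟨k, hk⟩ := hsupp _ hs' (fun i => by
    by_cases hm : M i j = 0
    · simp [hm, hsj i hm]
    · simpa using ht i hm) (fun h => hi (by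
      have := congrFun h i
      simpa [sub_eq_zero] using this))
  have hkj : k = j := hanti j k fun i hik hm => hk i hik (by simp [hm, hsj i hm])
  exact hk i₀ (hkj ▸ hi₀) (by simpa using hti₀)

/-! ### Gale duality -/

/-- A linear form `l` that vanishes wherever finitely many linear forms `L k` do is a combination
of them; in coordinates. -/
theorem exists_eq_sum_of_forall_sum_eq_zero {κ : Type*} [Fintype κ] {n : ℕ} {L : κ → Fin n → ℝ}
    {l : Fin n → ℝ} (h : ∀ s : Fin n → ℝ, (∀ k, ∑ i, L k i * s i = 0) → ∑ i, l i * s i = 0) :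
    ∃ c : κ → ℝ, ∀ i, l i = ∑ k, c k * L k i := by
  have hmem : dotProductEquiv ℝ (Fin n) l ∈
      Submodule.span ℝ (Set.range fun k => dotProductEquiv ℝ (Fin n) (L k)) := by
    refine mem_span_of_iInf_ker_le_ker fun s hs => ?_
    rw [LinearMap.mem_ker, dotProductEquiv_apply_apply]
    refine h s fun k => ?_
    rw [Submodule.mem_iInf] at hs
    exact hs k
  obtain ⟨c, hc⟩ := (Submodule.mem_span_range_iff_exists_fun ℝ).1 hmem
  refine ⟨c, fun i => ?_⟩
  have := LinearMap.congr_fun hc (Pi.single i 1)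
  simp only [LinearMap.sum_apply, LinearMap.smul_apply, dotProductEquiv_apply_apply,
    dotProduct_single, mul_one, smul_eq_mul] at this
  exact this.symm

section Gale

variable {n d m : ℕ}

/-- The linear dependencies of the vectors `c i • g i`. -/
def galeKernel (c : Fin n → ℝ) (g : Fin n → Fin m → ℝ) : Submodule ℝ (Fin n → ℝ) :=
  LinearMap.ker (Matrix.mulVecLin (Matrix.of fun k i => c i * g i k))

theorem mem_galeKernel {c : Fin n → ℝ} {g : Fin n → Fin m → ℝ} {s : Fin n → ℝ} :
    s ∈ galeKernel c g ↔ ∀ k, ∑ i, c i * g i k * s i = 0 := by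
  rw [galeKernel, LinearMap.mem_ker, funext_iff]
  rfl

theorem finrank_galeKernel_add_rank {c : Fin n → ℝ} (hc : ∀ i, 0 < c i)
    (g : Matrix (Fin n) (Fin m) ℝ) :
    Module.finrank ℝ (galeKernel c g) + g.rank = n := by
  have h := LinearMap.finrank_range_add_finrank_ker
    (Matrix.mulVecLin (Matrix.of fun k i => c i * g i k))
  have hr : (Matrix.of fun k i => c i * g i k).rank = g.rank := by
    have : (Matrix.of fun k i => c i * g i k) = (Matrix.diagonal c * g).transpose := by
      ext k i
      simp [Matrix.diagonal_mul]
    rw [this, Matrix.rank_transpose, Matrix.rank_mul_eq_right_of_det_ne_zero]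
    rw [Matrix.det_diagonal]
    exact (Finset.prod_pos fun i _ => hc i).ne'
  rw [Matrix.rank] at hr
  rw [hr, Module.finrank_fin_fun] at h
  have hdef : galeKernel c g =
      LinearMap.ker (Matrix.mulVecLin (Matrix.of fun k i => c i * g i k)) := rfl
  rw [hdef]
  omega

/-- Vectors of rank `m` with a positive dependency are a Gale diagram of points in dimension
`n - m - 1`: the coordinates of the points complete the constant vector to a basis of the
dependencies of the rescaled vectors. -/
theorem exists_hasGaleDiagram {g : Matrix (Fin n) (Fin m) ℝ} (hg : g.rank + (d + 1) = n)
    {c : Fin n → ℝ} (hc : ∀ i, 0 < c i) (hsum : ∀ k, ∑ i, c i * g i k = 0) :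
    ∃ p : Fin n → Fin d → ℝ, HasGaleDiagram p g := by
  have hdim : Module.finrank ℝ (galeKernel c g) = d + 1 := by
    have := finrank_galeKernel_add_rank hc g
    omega
  have hone : (fun _ => 1) ∈ galeKernel c g := mem_galeKernel.2 fun k => by simpa using hsum k
  let e : galeKernel c g := ⟨fun _ => 1, hone⟩
  have he : e ≠ 0 := by
    intro h
    have hn : 0 < n := by omega
    have := congrFun (congrArg Subtype.val h) ⟨0, hn⟩
    simp [e] at this
  obtain ⟨Q, hQ⟩ := (Submodule.span ℝ {e}).exists_isCompl
  have hQd : Module.finrank ℝ Q = d := by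
    have := Submodule.finrank_add_eq_of_isCompl hQ
    rw [finrank_span_singleton he, hdim] at this
    omega
  have : Module.Free ℝ Q := Module.Free.of_divisionRing ℝ Q
  have : Module.Finite ℝ Q := FiniteDimensional.finiteDimensional_submodule Q
  let b : Module.Basis (Fin d) ℝ Q := Module.finBasisOfFinrankEq ℝ Q hQd
  refine ⟨fun i k => (b k : galeKernel c g).1 i, c, hc, ?_⟩
  ext l
  simp only [Set.mem_ofPred_eq]
  constructor
  · rintro ⟨h1, h2⟩
    -- `l` is orthogonal to all dependencies of the vectors
    have horth : ∀ s ∈ galeKernel c g, ∑ i, l i * s i = 0 := by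
      intro s hs
      let φ : galeKernel c g →ₗ[ℝ] ℝ := dotProductEquiv ℝ (Fin n) l ∘ₗ (galeKernel c g).subtype
      have hφ : ∀ s : galeKernel c g, φ s = ∑ i, l i * s.1 i := fun s => rfl
      have htop : (⊤ : Submodule ℝ (galeKernel c g)) ≤ LinearMap.ker φ := by
        rw [← hQ.sup_eq_top, sup_le_iff]
        constructor
        · rw [Submodule.span_singleton_le_iff_mem, LinearMap.mem_ker, hφ]
          simpa [e] using h1
        · intro q hq
          have hb := b.sum_repr ⟨q, hq⟩
          have hq' : q = ∑ k, b.repr ⟨q, hq⟩ k • (b k : galeKernel c g) := by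
            conv_lhs => rw [show q = ((⟨q, hq⟩ : Q) : galeKernel c g) from rfl, ← hb]
            rw [Submodule.coe_sum]
            rfl
          rw [LinearMap.mem_ker, hq', map_sum]
          refine Finset.sum_eq_zero fun k _ => ?_
          rw [map_smul, hφ]
          have := congrFun h2 k
          simp only [Finset.sum_apply, Pi.smul_apply, smul_eq_mul, Pi.zero_apply] at this
          rw [this, smul_zero]
      exact htop (Submodule.mem_top (x := ⟨s, hs⟩))
    obtain ⟨u, hu⟩ := exists_eq_sum_of_forall_sum_eq_zero (κ := Fin m)
      (L := fun k i => c i * g i k) (l := l) fun s hs => horth s (mem_galeKernel.2 hs)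
    refine ⟨u, fun i => ?_⟩
    rw [hu, dotProduct]
    rfl
  · rintro ⟨u, hu⟩
    have key : ∀ s ∈ galeKernel c g, ∑ i, l i * s i = 0 := by
      intro s hs
      simp only [hu, dotProduct, Pi.smul_apply, smul_eq_mul, Finset.sum_mul]
      rw [Finset.sum_comm]
      refine Finset.sum_eq_zero fun k _ => ?_
      have := mem_galeKernel.1 hs k
      simp only [mul_assoc, ← Finset.mul_sum] at this ⊢
      rw [this, mul_zero]
    refine ⟨by simpa using key _ hone, ?_⟩
    ext k
    simpa using key _ (b k : galeKernel c g).2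

variable {p : Fin n → Fin d → ℝ} {c : Fin n → ℝ} {g : Fin n → Fin m → ℝ}

/-- The values of an affine function at the points are dependencies of the Gale vectors. -/
theorem affine_mem_galeKernel
    (h : {l : Fin n → ℝ | ∑ i, l i = 0 ∧ ∑ i, l i • p i = 0} =
      {l : Fin n → ℝ | ∃ u : Fin m → ℝ, ∀ i, l i = u ⬝ᵥ (c i • g i)}) (a : Fin d → ℝ) (b : ℝ) :
    (fun i => b - a ⬝ᵥ p i) ∈ galeKernel c g := by
  rw [mem_galeKernel]
  intro k
  have hk : (fun i => c i * g i k) ∈ {l : Fin n → ℝ | ∑ i, l i = 0 ∧ ∑ i, l i • p i = 0} := by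
    rw [h]
    exact ⟨Pi.single k 1, fun i => by simp⟩
  obtain ⟨h1, h2⟩ := hk
  have h3 := congrArg (fun x => a ⬝ᵥ x) h2
  simp only [dotProduct_sum, dotProduct_smul, dotProduct_zero, smul_eq_mul] at h3
  simp only [mul_sub, Finset.sum_sub_distrib, ← Finset.sum_mul, h1, h3]
  ring

/-- Every dependency of the Gale vectors consists of the values of an affine function at the
points. -/
theorem exists_affine_of_mem_galeKernel
    (h : {l : Fin n → ℝ | ∑ i, l i = 0 ∧ ∑ i, l i • p i = 0} =
      {l : Fin n → ℝ | ∃ u : Fin m → ℝ, ∀ i, l i = u ⬝ᵥ (c i • g i)}) {s : Fin n → ℝ}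
    (hs : s ∈ galeKernel c g) : ∃ (a : Fin d → ℝ) (b : ℝ), ∀ i, s i = b - a ⬝ᵥ p i := by
  obtain ⟨t, ht⟩ := exists_eq_sum_of_forall_sum_eq_zero (κ := Option (Fin d))
    (L := fun k i => k.elim 1 (p i)) (l := s) fun l hl => by
      have hl' : l ∈ {l : Fin n → ℝ | ∑ i, l i = 0 ∧ ∑ i, l i • p i = 0} := by
        refine ⟨by simpa using hl none, ?_⟩
        ext k
        simpa [mul_comm] using hl (some k)
      rw [h] at hl'
      obtain ⟨u, hu⟩ := hl'
      rw [mem_galeKernel] at hs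
      simp only [hu, dotProduct, Pi.smul_apply, smul_eq_mul, Finset.mul_sum]
      rw [Finset.sum_comm]
      refine Finset.sum_eq_zero fun k _ => ?_
      have : ∀ i, s i * (u k * (c i * g i k)) = u k * (c i * g i k * s i) := fun i => by ring
      simp only [this, ← Finset.mul_sum, hs k, mul_zero]
  refine ⟨fun k => -t (some k), t none, fun i => ?_⟩
  rw [ht, Fintype.sum_option]
  simp [dotProduct]

/-- By a dimension count, no nonzero linear functional is constant on the points. -/
theorem eq_zero_of_forall_dotProduct_eq (hn : d + 1 + m ≤ n)
    (h : {l : Fin n → ℝ | ∑ i, l i = 0 ∧ ∑ i, l i • p i = 0} =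
      {l : Fin n → ℝ | ∃ u : Fin m → ℝ, ∀ i, l i = u ⬝ᵥ (c i • g i)}) {a : Fin d → ℝ} {b : ℝ}
    (hab : ∀ i, a ⬝ᵥ p i = b) : a = 0 := by
  let T : (Fin d → ℝ) × ℝ →ₗ[ℝ] galeKernel c g :=
    { toFun := fun x => ⟨fun i => x.2 - x.1 ⬝ᵥ p i, affine_mem_galeKernel h x.1 x.2⟩
      map_add' := fun x y => by
        ext i
        simp only [Prod.snd_add, Prod.fst_add, add_dotProduct, Submodule.coe_add, Pi.add_apply]
        ring
      map_smul' := fun r x => by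
        ext i
        simp [smul_dotProduct, mul_sub] }
  have hsurj : Function.Surjective T := by
    rintro ⟨s, hs⟩
    obtain ⟨a, b, hab⟩ := exists_affine_of_mem_galeKernel h hs
    exact ⟨(a, b), Subtype.ext (funext fun i => (hab i).symm)⟩
  have hdom : Module.finrank ℝ ((Fin d → ℝ) × ℝ) = d + 1 := by simp
  have hge : d + 1 ≤ Module.finrank ℝ (galeKernel c g) := by
    have h1 := LinearMap.finrank_range_add_finrank_ker
      (Matrix.mulVecLin (Matrix.of fun k i => c i * g i k))
    have h2 := Submodule.finrank_le
      (LinearMap.range (Matrix.mulVecLin (Matrix.of fun k i => c i * g i k)))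
    rw [Module.finrank_fin_fun] at h1 h2
    rw [galeKernel]
    omega
  have hle := LinearMap.finrank_le_finrank_of_surjective hsurj
  have hinj : Function.Injective T :=
    (LinearMap.injective_iff_surjective_of_finrank_eq_finrank (by omega)).2 hsurj
  have h0 : T (a, b) = T 0 := by
    ext i
    simp [T, hab i]
  exact congrArg Prod.fst (hinj h0)

/-- Points with a Gale diagram are the vertices of a polytope whose facets are given by a matrix
`M` of positive circuits of the diagram, as soon as the support of every nonnegative dependency
contains that of a column and the supports separate columns and rows. -/
theorem exists_isLabelledPolytope_of_gale {f : ℕ} [Nonempty (Fin n)] (hn : d + 1 + m ≤ n)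
    (h : {l : Fin n → ℝ | ∑ i, l i = 0 ∧ ∑ i, l i • p i = 0} =
      {l : Fin n → ℝ | ∃ u : Fin m → ℝ, ∀ i, l i = u ⬝ᵥ (c i • g i)})
    {M : Matrix (Fin n) (Fin f) ℝ} (hM : ∀ i j, 0 ≤ M i j)
    (hK : ∀ j, (fun i => M i j) ∈ galeKernel c g)
    (hsupp : ∀ s ∈ galeKernel c g, (∀ i, 0 ≤ s i) → s ≠ 0 → ∃ j, ∀ i, M i j ≠ 0 → s i ≠ 0)
    (hzero : ∀ j, ∃ i, M i j = 0) (hnz : ∀ j, ∃ i, M i j ≠ 0)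
    (hanti : ∀ j k, (∀ i, M i k ≠ 0 → M i j ≠ 0) → k = j)
    (hrows : ∀ i k, i ≠ k → ∃ j, M i j = 0 ∧ M k j ≠ 0) :
    ∃ (W : Matrix (Fin f) (Fin d) ℝ) (w : Fin f → ℝ),
      slackMatrix p W w = M ∧ IsLabelledPolytope p W w := by
  choose W w hWw using fun j => exists_affine_of_mem_galeKernel h (hK j)
  have hS : slackMatrix p (Matrix.of W) w = M := by
    ext i j
    exact (hWw j i).symm
  refine ⟨Matrix.of W, w, hS, ?_⟩
  subst hS
  exact isLabelledPolytope_of_slackMatrix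
    (fun a b hab => eq_zero_of_forall_dotProduct_eq hn h hab) hM
    (fun a b hab => exists_nonneg_combination hM hnz hK hsupp _
      (affine_mem_galeKernel h a b) fun i => sub_nonneg.2 (hab i))
    (fun j a b hab => exists_eq_mul_of_support_subset hM hnz hK hsupp hanti j
      (affine_mem_galeKernel h a b) fun i hi => sub_eq_zero.2 (hab i hi).symm)
    hzero hnz (fun j k hjk => hanti k j fun i hi hk => hi ((hjk i).2 hk)) hrows

end Gale

/-! ### The Perles configuration over `ℤ[√5]` -/

/-- The vectors of the Perles Gale diagram, multiplied by `2` (the last one by `10`), with entries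
in `ℤ[√5]`. -/
def perlesGaleInt : Matrix (Fin 12) (Fin 3) (ℤ√5) :=
  ![
    ![⟨-2, -2⟩, ⟨0, 0⟩, ⟨2, 0⟩], ![⟨6, 2⟩, ⟨0, 0⟩, ⟨2, 0⟩], ![⟨-1, -1⟩, ⟨3, 1⟩, ⟨2, 0⟩],
    ![⟨5, 1⟩, ⟨3, 1⟩, ⟨2, 0⟩], ![⟨0, 0⟩, ⟨0, 0⟩, ⟨2, 0⟩], ![⟨4, 0⟩, ⟨0, 0⟩, ⟨2, 0⟩],
    ![⟨1, -1⟩, ⟨2, 0⟩, ⟨2, 0⟩], ![⟨3, 1⟩, ⟨2, 0⟩, ⟨2, 0⟩], ![⟨-4, 0⟩, ⟨0, 0⟩, ⟨-2, 0⟩],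
    ![⟨-1, 1⟩, ⟨-2, 0⟩, ⟨-2, 0⟩], ![⟨-3, -1⟩, ⟨-2, 0⟩, ⟨-2, 0⟩], ![⟨-10, 0⟩, ⟨-5, -1⟩, ⟨-10, 0⟩]]

/-- For each cofacet, the coefficients of the positive linear dependency of the vectors
`perlesGaleInt i` with that support. -/
def perlesCircuit : Fin 34 → List (Fin 12 × ℤ√5) :=
  ![
    [(5, ⟨1, 0⟩), (8, ⟨1, 0⟩)],
    [(6, ⟨1, 0⟩), (9, ⟨1, 0⟩)],
    [(7, ⟨1, 0⟩), (10, ⟨1, 0⟩)],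
    [(0, ⟨-1, 1⟩), (1, ⟨2, 0⟩), (8, ⟨1, 1⟩)],
    [(0, ⟨2, 0⟩), (3, ⟨-1, 1⟩), (9, ⟨1, 1⟩)],
    [(0, ⟨0, 2⟩), (7, ⟨5, 3⟩), (11, ⟨1, 1⟩)],
    [(1, ⟨2, 0⟩), (2, ⟨-1, 1⟩), (10, ⟨1, 1⟩)],
    [(1, ⟨-1, 1⟩), (4, ⟨2, 0⟩), (8, ⟨1, 1⟩)],
    [(1, ⟨0, 2⟩), (6, ⟨5, 3⟩), (11, ⟨1, 1⟩)],
    [(2, ⟨-1, 1⟩), (4, ⟨2, 0⟩), (9, ⟨1, 1⟩)],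
    [(2, ⟨0, 2⟩), (5, ⟨5, 3⟩), (11, ⟨1, 1⟩)],
    [(3, ⟨0, 2⟩), (4, ⟨5, 3⟩), (11, ⟨1, 1⟩)],
    [(3, ⟨-1, 1⟩), (5, ⟨2, 0⟩), (10, ⟨1, 1⟩)],
    [(0, ⟨2, 0⟩), (1, ⟨-1, 1⟩), (2, ⟨2, 0⟩), (9, ⟨3, 1⟩)],
    [(0, ⟨0, 2⟩), (1, ⟨5, 1⟩), (2, ⟨0, 2⟩), (11, ⟨1, 1⟩)],
    [(0, ⟨-1, 1⟩), (1, ⟨2, 0⟩), (3, ⟨2, 0⟩), (10, ⟨3, 1⟩)],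
    [(0, ⟨5, 1⟩), (1, ⟨0, 2⟩), (3, ⟨0, 2⟩), (11, ⟨1, 1⟩)],
    [(0, ⟨-1, 1⟩), (2, ⟨2, 0⟩), (5, ⟨2, 0⟩), (9, ⟨3, 1⟩)],
    [(0, ⟨2, 0⟩), (2, ⟨-1, 1⟩), (7, ⟨2, 0⟩), (9, ⟨3, 1⟩)],
    [(0, ⟨0, 2⟩), (3, ⟨0, 2⟩), (5, ⟨5, 1⟩), (11, ⟨1, 1⟩)],
    [(0, ⟨2, 0⟩), (7, ⟨1, 1⟩), (8, ⟨2, 0⟩), (9, ⟨1, 1⟩)],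
    [(1, ⟨0, 2⟩), (2, ⟨0, 2⟩), (4, ⟨5, 1⟩), (11, ⟨1, 1⟩)],
    [(1, ⟨-1, 1⟩), (3, ⟨2, 0⟩), (4, ⟨2, 0⟩), (10, ⟨3, 1⟩)],
    [(1, ⟨2, 0⟩), (3, ⟨-1, 1⟩), (6, ⟨2, 0⟩), (10, ⟨3, 1⟩)],
    [(1, ⟨1, 0⟩), (6, ⟨1, 0⟩), (8, ⟨1, 0⟩), (10, ⟨1, 0⟩)],
    [(2, ⟨5, -2⟩), (4, ⟨0, 1⟩), (7, ⟨0, 1⟩), (11, ⟨1, 0⟩)],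
    [(2, ⟨2, 0⟩), (5, ⟨1, 1⟩), (9, ⟨1, 1⟩), (10, ⟨2, 0⟩)],
    [(3, ⟨3, -1⟩), (4, ⟨1, 1⟩), (8, ⟨2, 0⟩), (9, ⟨2, 0⟩)],
    [(3, ⟨2, 0⟩), (4, ⟨1, 1⟩), (9, ⟨2, 0⟩), (10, ⟨1, 1⟩)],
    [(3, ⟨5, -2⟩), (5, ⟨0, 1⟩), (6, ⟨0, 1⟩), (11, ⟨1, 0⟩)],
    [(4, ⟨0, 2⟩), (6, ⟨0, 2⟩), (7, ⟨5, 1⟩), (11, ⟨1, 1⟩)],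
    [(4, ⟨2, 0⟩), (7, ⟨-1, 1⟩), (8, ⟨2, 0⟩), (9, ⟨-1, 1⟩)],
    [(4, ⟨0, 2⟩), (7, ⟨0, 2⟩), (8, ⟨5, -1⟩), (11, ⟨-1, 1⟩)],
    [(5, ⟨0, 2⟩), (6, ⟨5, 1⟩), (7, ⟨0, 2⟩), (11, ⟨1, 1⟩)]]

/-- The matrix whose columns are the circuits `perlesCircuit j`. -/
def perlesSlackInt : Matrix (Fin 12) (Fin 34) (ℤ√5) :=
  Matrix.of fun i j => ((perlesCircuit j).lookup i).getD 0

/-- The maximal sets of vectors of the Gale diagram that lie in an open half-space. -/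
def perlesHalfspace : Fin 21 → Finset (Fin 12) :=
  ![
    {0, 4, 8, 9, 10, 11}, {0, 2, 4, 6, 8, 10, 11}, {0, 2, 8, 9, 10, 11}, {0, 2, 3, 4, 6, 8, 10},
    {0, 2, 3, 4, 6, 7, 8}, {0, 2, 3, 6, 8, 10, 11}, {0, 4, 5, 6, 10, 11}, {0, 2, 4, 5, 6, 10},
    {2, 3, 8, 9, 10, 11}, {0, 1, 4, 5, 9, 10, 11}, {0, 1, 4, 5, 6, 10}, {0, 1, 2, 3, 4, 5, 6, 7},
    {2, 3, 6, 7, 8, 11}, {0, 1, 4, 5, 7, 9}, {1, 4, 5, 7, 9, 11}, {1, 3, 4, 5, 7, 9},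
    {1, 3, 8, 9, 10, 11}, {1, 2, 3, 7, 8, 9, 11}, {1, 2, 3, 6, 7, 8}, {1, 3, 5, 7, 9, 11},
    {1, 2, 3, 5, 7, 9}]

/-- Linear functionals that are positive on the sets `perlesHalfspace k`. -/
def perlesFunctional : Fin 21 → Fin 3 → ℤ :=
  ![
    ![-1, -2, 1], ![-2, 0, 1], ![-1, 0, -1], ![-2, 3, 1], ![-1, 2, 1], ![-1, 2, -1],
    ![-1, -3, 3], ![-1, -1, 3], ![0, 1, -2], ![0, -2, 1], ![-1, -4, 6], ![0, 0, 1],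
    ![0, 4, -3], ![1, -4, 4], ![1, -3, 1], ![1, -1, 1], ![1, 0, -3], ![1, 2, -3],
    ![1, 4, -3], ![2, -2, -1], ![2, 2, -1]]

/-- A criterion, decidable in integers, for `z.re + z.im * √5` to be positive. -/
def IsPosSqrtFive (z : ℤ√5) : Prop :=
  (0 < z.re ∧ 0 ≤ z.im) ∨ (0 ≤ z.re ∧ 0 < z.im) ∨ (0 < z.re ∧ 5 * z.im ^ 2 < z.re ^ 2) ∨
    (0 < z.im ∧ z.re ^ 2 < 5 * z.im ^ 2)

instance : DecidablePred IsPosSqrtFive := fun _ => by unfold IsPosSqrtFive; infer_instance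

theorem sum_perlesSlackInt_mul : ∀ j k, ∑ i, perlesSlackInt i j * perlesGaleInt i k = 0 := by
  decide +kernel

theorem perlesSlackInt_ne_zero_iff : ∀ j i, perlesSlackInt i j ≠ 0 ↔ i ∈ perlesCofacet j := by
  decide +kernel

theorem isPosSqrtFive_perlesSlackInt :
    ∀ j, ∀ i ∈ perlesCofacet j, IsPosSqrtFive (perlesSlackInt i j) := by
  decide +kernel

theorem isPosSqrtFive_perlesFunctional : ∀ k, ∀ i ∈ perlesHalfspace k,
    IsPosSqrtFive (∑ l, (perlesFunctional k l : ℤ√5) * perlesGaleInt i l) := by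
  decide +kernel

theorem eq_of_perlesCofacet_subset : ∀ j k, perlesCofacet k ⊆ perlesCofacet j → k = j := by
  decide +kernel

theorem exists_perlesCofacet_separating :
    ∀ i k, i ≠ k → ∃ j, i ∉ perlesCofacet j ∧ k ∈ perlesCofacet j := by
  decide +kernel

theorem exists_mem_perlesCofacet : ∀ j, ∃ i, i ∈ perlesCofacet j := by
  decide +kernel

theorem exists_notMem_perlesCofacet : ∀ j, ∃ i, i ∉ perlesCofacet j := by
  decide +kernel

theorem exists_perlesCofacet_mem : ∀ i, ∃ j, i ∈ perlesCofacet j := by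
  decide +kernel

/-- A branching test, deciding for one element of the list after the other whether it belongs to a
set, of whether each subset of the list contains a member of `C` or is contained in a member
of `H`. -/
def coverCheck {α : Type*} [DecidableEq α] :
    List α → List (Finset α) → List (Finset α) → Bool
  | [], C, H => C.any (fun c => c = ∅) || !H.isEmpty
  | i :: l, C, H => C.any (fun c => c = ∅) ||
      (coverCheck l (C.map fun c => c.erase i) (H.filter fun h => i ∈ h) &&
        coverCheck l (C.filter fun c => i ∉ c) H)

theorem exists_subset_of_coverCheck {α : Type*} [DecidableEq α] (l : List α)
    (C H : List (Finset α)) (h : coverCheck l C H = true) (T : Finset α) (hT : ∀ i ∈ T, i ∈ l) :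
    (∃ c ∈ C, c ⊆ T) ∨ ∃ h ∈ H, T ⊆ h := by
  induction l generalizing C H T with
  | nil =>
    obtain rfl : T = ∅ := Finset.eq_empty_of_forall_notMem fun i hi => by simpa using hT i hi
    simp only [coverCheck, Bool.or_eq_true, List.any_eq_true, decide_eq_true_eq] at h
    rcases h with ⟨c, hc, rfl⟩ | h
    · exact Or.inl ⟨∅, hc, le_rfl⟩
    · obtain ⟨x, hx⟩ := List.exists_mem_of_ne_nil H (by simpa using h)
      exact Or.inr ⟨x, hx, Finset.empty_subset _⟩
  | cons i l ih =>
    simp only [coverCheck, Bool.or_eq_true, Bool.and_eq_true, List.any_eq_true,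
      decide_eq_true_eq] at h
    rcases h with ⟨c, hc, rfl⟩ | ⟨h1, h2⟩
    · exact Or.inl ⟨∅, hc, Finset.empty_subset _⟩
    by_cases hi : i ∈ T
    · rcases ih _ _ h1 (T.erase i) (fun k hk => by
        have := hT k (Finset.mem_of_mem_erase hk)
        simpa [Finset.ne_of_mem_erase hk] using this) with ⟨c, hc, hcT⟩ | ⟨c, hc, hcT⟩
      · obtain ⟨c', hc', rfl⟩ := List.mem_map.1 hc
        refine Or.inl ⟨c', hc', fun k hk => ?_⟩
        by_cases hki : k = i
        · exact hki ▸ hi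
        · exact Finset.mem_of_mem_erase (hcT (Finset.mem_erase.2 ⟨hki, hk⟩))
      · simp only [List.mem_filter, decide_eq_true_eq] at hc
        refine Or.inr ⟨c, hc.1, fun k hk => ?_⟩
        by_cases hki : k = i
        · exact hki ▸ hc.2
        · exact hcT (Finset.mem_erase.2 ⟨hki, hk⟩)
    · rcases ih _ _ h2 T (fun k hk => by
        have := hT k hk
        simpa [show k ≠ i from fun e => hi (e ▸ hk)] using this) with ⟨c, hc, hcT⟩ | ⟨c, hc, hcT⟩
      · exact Or.inl ⟨c, (List.mem_filter.1 hc).1, hcT⟩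
      · exact Or.inr ⟨c, hc, hcT⟩

theorem coverCheck_perles : coverCheck (List.finRange 12) (List.ofFn perlesCofacet)
    (List.ofFn perlesHalfspace) = true := by
  decide +kernel

/-- Every set of vectors of the Gale diagram contains a cofacet or lies in an open half-space. -/
theorem exists_perlesCofacet_subset_or (T : Finset (Fin 12)) :
    (∃ j, perlesCofacet j ⊆ T) ∨ ∃ k, T ⊆ perlesHalfspace k := by
  have h := exists_subset_of_coverCheck _ _ _ coverCheck_perles T fun i _ => List.mem_finRange i
  rcases h with ⟨c, hc, hcT⟩ | ⟨c, hc, hcT⟩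
  · obtain ⟨j, rfl⟩ := List.mem_ofFn.1 hc
    exact Or.inl ⟨j, hcT⟩
  · obtain ⟨k, rfl⟩ := List.mem_ofFn.1 hc
    exact Or.inr ⟨k, hcT⟩

/-- The homomorphism from `ℤ[√5]` that sends `√5` to a given square root of five. -/
noncomputable def sqrtFiveHom {K : Type*} [CommRing K] (r : K) (hr : r * r = 5) : ℤ√5 →+* K :=
  Zsqrtd.lift ⟨r, by simpa using hr⟩

theorem sqrtFiveHom_apply {K : Type*} [CommRing K] {r : K} (hr : r * r = 5) (z : ℤ√5) :
    sqrtFiveHom r hr z = z.re + z.im * r := rfl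

section Hom

variable {K : Type*} [Field K] [CharZero K] {r : K} (hr : r * r = 5)

theorem sqrtFiveHom_injective : Function.Injective (sqrtFiveHom r hr) :=
  Zsqrtd.lift_injective _ fun n h => by
    have h1 : n < 3 := by nlinarith
    have h2 : -3 < n := by nlinarith
    interval_cases n <;> omega

theorem sqrtFiveHom_perlesSlackInt_ne_zero_iff (i : Fin 12) (j : Fin 34) :
    sqrtFiveHom r hr (perlesSlackInt i j) ≠ 0 ↔ i ∈ perlesCofacet j := by
  rw [← perlesSlackInt_ne_zero_iff, map_ne_zero_iff _ (sqrtFiveHom_injective hr)]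

theorem rank_perlesGaleInt_map : (perlesGaleInt.map (sqrtFiveHom r hr)).rank = 3 := by
  refine le_antisymm (Matrix.rank_le_width _) ?_
  have hdet : (perlesGaleInt.submatrix ![0, 4, 2] id).det ≠ 0 := by
    rw [Matrix.det_fin_three]
    decide +kernel
  have h1 : ((perlesGaleInt.map (sqrtFiveHom r hr)).submatrix ![0, 4, 2] id).det ≠ 0 := by
    have h2 := RingHom.map_det (sqrtFiveHom r hr) (perlesGaleInt.submatrix ![0, 4, 2] id)
    rw [RingHom.mapMatrix_apply, ← Matrix.submatrix_map] at h2
    rw [← h2, map_ne_zero_iff _ (sqrtFiveHom_injective hr)]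
    exact hdet
  have h3 := Matrix.rank_of_det_ne_zero h1
  have h4 := Matrix.rank_submatrix_le (perlesGaleInt.map (sqrtFiveHom r hr)) ![0, 4, 2] id
  rw [Fintype.card_fin] at h3
  omega

/-- The circuits are orthogonal to three independent vectors, whichever square root of five is
used. -/
theorem rank_perlesSlackInt_map_le : (perlesSlackInt.map (sqrtFiveHom r hr)).rank ≤ 9 := by
  have h0 : (perlesSlackInt.map (sqrtFiveHom r hr)).transpose *
      perlesGaleInt.map (sqrtFiveHom r hr) = 0 := by
    ext j k
    have h := congrArg (sqrtFiveHom r hr) (sum_perlesSlackInt_mul j k)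
    simpa [Matrix.mul_apply, map_sum, map_mul] using h
  have h1 := Matrix.rank_add_rank_le_card_of_mul_eq_zero h0
  rw [Matrix.rank_transpose, rank_perlesGaleInt_map, Fintype.card_fin] at h1
  omega

end Hom

theorem sqrtFiveHom_pos {z : ℤ√5} (hz : IsPosSqrtFive z) (hr : √5 * √5 = (5 : ℝ)) :
    0 < sqrtFiveHom √5 hr z := by
  rw [sqrtFiveHom_apply]
  have h5 : 0 < √(5 : ℝ) := by positivity
  rcases hz with ⟨h1, h2⟩ | ⟨h1, h2⟩ | ⟨h1, h2⟩ | ⟨h1, h2⟩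
  · have h1' : (0 : ℝ) < z.re := by exact_mod_cast h1
    have h2' : (0 : ℝ) ≤ z.im := by exact_mod_cast h2
    positivity
  · have h1' : (0 : ℝ) ≤ z.re := by exact_mod_cast h1
    have h2' : (0 : ℝ) < z.im := by exact_mod_cast h2
    positivity
  · have h1' : (0 : ℝ) < z.re := by exact_mod_cast h1
    have h2' : 5 * (z.im : ℝ) ^ 2 < (z.re : ℝ) ^ 2 := by exact_mod_cast h2
    have h3 : ((z.im : ℝ) * √5) ^ 2 < (z.re : ℝ) ^ 2 := by
      rw [mul_pow, sq √(5 : ℝ), hr]; linarith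
    have h4 := (abs_lt.1 (abs_lt_of_sq_lt_sq h3 h1'.le)).1
    linarith
  · have h1' : (0 : ℝ) < z.im := by exact_mod_cast h1
    have h2' : (z.re : ℝ) ^ 2 < 5 * (z.im : ℝ) ^ 2 := by exact_mod_cast h2
    have h3 : (z.re : ℝ) ^ 2 < ((z.im : ℝ) * √5) ^ 2 := by
      rw [mul_pow, sq √(5 : ℝ), hr]; linarith
    have h4 := (abs_lt.1 (abs_lt_of_sq_lt_sq h3 (by positivity))).1
    linarith

/-! ### The Perles polytope -/

theorem sqrt_five_mul_self : √5 * √5 = (5 : ℝ) := Real.mul_self_sqrt (by norm_num)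

/-- The factor that turns the integral vector `perlesGaleInt i` into the `i`-th vector of the Gale
diagram. -/
noncomputable def perlesScale (i : Fin 12) : ℝ := if i = 11 then 1 / 10 else 1 / 2

theorem perlesScale_pos (i : Fin 12) : 0 < perlesScale i := by
  unfold perlesScale
  split_ifs <;> norm_num

theorem perlesGale_eq (i : Fin 12) (k : Fin 3) :
    perlesGale i k = perlesScale i * sqrtFiveHom √5 sqrt_five_mul_self (perlesGaleInt i k) := by
  fin_cases i <;> fin_cases k <;>
    simp [perlesGale, perlesScale, perlesGaleInt, liftPoint, perlesPoint, sqrtFiveHom_apply] <;> ring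

theorem rank_perlesGale : Matrix.rank (Matrix.of perlesGale) = 3 := by
  have h : Matrix.of perlesGale = Matrix.diagonal perlesScale *
      perlesGaleInt.map (sqrtFiveHom √5 sqrt_five_mul_self) := by
    ext i k
    simp [Matrix.diagonal_mul, perlesGale_eq]
  rw [h, Matrix.rank_mul_eq_right_of_det_ne_zero, rank_perlesGaleInt_map]
  rw [Matrix.det_diagonal]
  exact (Finset.prod_pos fun i _ => perlesScale_pos i).ne'

theorem sqrtFiveHom_perlesSlackInt_nonneg (i : Fin 12) (j : Fin 34) :
    0 ≤ sqrtFiveHom √5 sqrt_five_mul_self (perlesSlackInt i j) := by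
  by_cases hi : i ∈ perlesCofacet j
  · exact (sqrtFiveHom_pos (isPosSqrtFive_perlesSlackInt j i hi) _).le
  · rw [← perlesSlackInt_ne_zero_iff, not_not] at hi
    rw [hi, map_zero]

theorem sum_sqrtFiveHom_perlesSlackInt_mul (j : Fin 34) (k : Fin 3) :
    ∑ i, sqrtFiveHom √5 sqrt_five_mul_self (perlesSlackInt i j) *
      sqrtFiveHom √5 sqrt_five_mul_self (perlesGaleInt i k) = 0 := by
  have h := congrArg (sqrtFiveHom √5 sqrt_five_mul_self) (sum_perlesSlackInt_mul j k)
  simpa [map_sum, map_mul] using h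

theorem exists_hasGaleDiagram_perlesGale : ∃ p : Fin 12 → Fin 8 → ℝ,
    HasGaleDiagram p perlesGale := by
  -- the sum of all circuits is a positive dependency
  refine exists_hasGaleDiagram (g := Matrix.of perlesGale) (by rw [rank_perlesGale])
    (c := fun i => (∑ j, sqrtFiveHom √5 sqrt_five_mul_self (perlesSlackInt i j)) / perlesScale i)
    (fun i => div_pos ?_ (perlesScale_pos i)) fun k => ?_
  · obtain ⟨j, hj⟩ := exists_perlesCofacet_mem i
    exact Finset.sum_pos' (fun j _ => sqrtFiveHom_perlesSlackInt_nonneg i j)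
      ⟨j, Finset.mem_univ _, sqrtFiveHom_pos (isPosSqrtFive_perlesSlackInt j i hj) _⟩
  · have : ∀ i, (∑ j, sqrtFiveHom √5 sqrt_five_mul_self (perlesSlackInt i j)) / perlesScale i *
        Matrix.of perlesGale i k = ∑ j, sqrtFiveHom √5 sqrt_five_mul_self (perlesSlackInt i j) *
          sqrtFiveHom √5 sqrt_five_mul_self (perlesGaleInt i k) := by
      intro i
      have := (perlesScale_pos i).ne'
      rw [Matrix.of_apply, perlesGale_eq, ← Finset.sum_mul]
      field_simp
    simp only [this]
    rw [Finset.sum_comm]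
    exact Finset.sum_eq_zero fun j _ => sum_sqrtFiveHom_perlesSlackInt_mul j k

/-- A nonzero nonnegative dependency cannot be supported in an open half-space, so its support
contains a cofacet. -/
theorem exists_perlesCofacet_of_mem_galeKernel {c s : Fin 12 → ℝ} (hc : ∀ i, 0 < c i)
    (hs : s ∈ galeKernel c perlesGale) (h0 : ∀ i, 0 ≤ s i) (hne : s ≠ 0) :
    ∃ j, ∀ i ∈ perlesCofacet j, s i ≠ 0 := by
  rcases exists_perlesCofacet_subset_or (Finset.univ.filter fun i => s i ≠ 0) with ⟨j, hj⟩ | ⟨k, hk⟩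
  · exact ⟨j, fun i hi => (Finset.mem_filter.1 (hj hi)).2⟩
  · exfalso
    obtain ⟨i₀, hi₀⟩ := Function.ne_iff.1 hne
    let φ := sqrtFiveHom √5 sqrt_five_mul_self
    let e : Fin 12 → ℝ := fun i => φ (∑ l, (perlesFunctional k l : ℤ√5) * perlesGaleInt i l)
    have he : ∀ i, s i ≠ 0 → 0 < e i := fun i hi =>
      sqrtFiveHom_pos (isPosSqrtFive_perlesFunctional k i (hk (by simpa using hi))) _
    have hsum : ∑ i, c i * perlesScale i * s i * e i = 0 := by
      have hl : ∀ i, c i * perlesScale i * s i * e i =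
          ∑ l, (perlesFunctional k l : ℝ) * (c i * perlesGale i l * s i) := by
        intro i
        simp only [e, φ, map_sum, map_mul, map_intCast, Finset.mul_sum, perlesGale_eq]
        refine Finset.sum_congr rfl fun l _ => ?_
        ring
      simp only [hl]
      rw [Finset.sum_comm]
      refine Finset.sum_eq_zero fun l _ => ?_
      rw [← Finset.mul_sum, mem_galeKernel.1 hs l, mul_zero]
    have hpos : 0 < ∑ i, c i * perlesScale i * s i * e i := by
      have hterm : ∀ i, s i ≠ 0 → 0 < c i * perlesScale i * s i * e i := fun i hi =>
        mul_pos (mul_pos (mul_pos (hc i) (perlesScale_pos i)) (lt_of_le_of_ne (h0 i) hi.symm))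
          (he i hi)
      refine Finset.sum_pos' (fun i _ => ?_) ⟨i₀, Finset.mem_univ _, hterm i₀ hi₀⟩
      by_cases hi : s i = 0
      · simp [hi]
      · exact (hterm i hi).le
    exact hpos.ne' hsum

theorem exists_isLabelledPolytope_of_perlesGale {p : Fin 12 → Fin 8 → ℝ}
    (hp : HasGaleDiagram p perlesGale) :
    ∃ (W : Matrix (Fin 34) (Fin 8) ℝ) (w : Fin 34 → ℝ), IsLabelledPolytope p W w ∧
      ∀ i j, slackMatrix p W w i j ≠ 0 ↔ i ∈ perlesCofacet j := by
  obtain ⟨c, hc, h⟩ := hp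
  let M : Matrix (Fin 12) (Fin 34) ℝ := Matrix.of fun i j =>
    sqrtFiveHom √5 sqrt_five_mul_self (perlesSlackInt i j) / (c i * perlesScale i)
  have hden : ∀ i, 0 < c i * perlesScale i := fun i => mul_pos (hc i) (perlesScale_pos i)
  have hMne : ∀ i j, M i j ≠ 0 ↔ i ∈ perlesCofacet j := by
    intro i j
    rw [← sqrtFiveHom_perlesSlackInt_ne_zero_iff sqrt_five_mul_self]
    simp [M, (hc i).ne', (perlesScale_pos i).ne']
  have hMz : ∀ i j, M i j = 0 ↔ i ∉ perlesCofacet j := fun i j => by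
    rw [← hMne, not_not]
  obtain ⟨W, w, hW, hpoly⟩ := exists_isLabelledPolytope_of_gale (M := M) (by norm_num) h
    (fun i j => div_nonneg (sqrtFiveHom_perlesSlackInt_nonneg i j) (hden i).le)
    (fun j => mem_galeKernel.2 fun k => by
      rw [← sum_sqrtFiveHom_perlesSlackInt_mul j k]
      refine Finset.sum_congr rfl fun i _ => ?_
      have h1 := (hc i).ne'
      have h2 := (perlesScale_pos i).ne'
      simp only [M, Matrix.of_apply, perlesGale_eq]
      field_simp)
    (fun s hs h0 hne => by
      simpa only [hMne] using exists_perlesCofacet_of_mem_galeKernel hc hs h0 hne)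
    (by simpa only [hMz] using exists_notMem_perlesCofacet)
    (by simpa only [hMne] using exists_mem_perlesCofacet)
    (by simp only [hMne]; exact fun j k hjk => eq_of_perlesCofacet_subset j k hjk)
    (by simpa only [hMne, hMz] using exists_perlesCofacet_separating)
  exact ⟨W, w, hpoly, by rw [hW]; exact hMne⟩

/-! ### The relation forced by the incidences -/

/-- The left kernel of a matrix with Perles support and rank at most nine has dimension at least
three, and it is parametrized by the values at `E`, `F` and `-I`, since the first thirteen columns
determine the other values. -/
theorem exists_leftKernel_vector {M : Matrix (Fin 12) (Fin 34) ℂ}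
    (hM : ∀ i j, M i j ≠ 0 ↔ i ∈ perlesCofacet j) (hrank : M.rank ≤ 9) (x : Fin 3 → ℂ) :
    ∃ l : Fin 12 → ℂ, (∀ j, ∑ i ∈ perlesCofacet j, M i j * l i = 0) ∧
      l 4 = x 0 ∧ l 5 = x 1 ∧ l 11 = x 2 := by
  have hcol : ∀ (l : Fin 12 → ℂ) (j : Fin 34), (M.transpose.mulVecLin l) j =
      ∑ i ∈ perlesCofacet j, M i j * l i := by
    intro l j
    rw [Matrix.mulVecLin_apply, Matrix.mulVec, dotProduct]
    refine (Finset.sum_subset (Finset.subset_univ _) fun i _ hi => ?_).symm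
    have : M i j = 0 := by
      by_contra h
      exact hi ((hM i j).1 h)
    simp [this]
  let K := LinearMap.ker M.transpose.mulVecLin
  have hK : ∀ l ∈ K, ∀ j, ∑ i ∈ perlesCofacet j, M i j * l i = 0 := by
    intro l hl j
    rw [← hcol, LinearMap.mem_ker.1 hl, Pi.zero_apply]
  have hdim : 3 ≤ Module.finrank ℂ K := by
    have h1 := LinearMap.finrank_range_add_finrank_ker M.transpose.mulVecLin
    have h2 : Module.finrank ℂ (LinearMap.range M.transpose.mulVecLin) ≤ 9 := by
      rw [← M.rank_transpose] at hrank
      exact hrank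
    rw [Module.finrank_fin_fun] at h1
    change 3 ≤ Module.finrank ℂ (LinearMap.ker M.transpose.mulVecLin)
    omega
  let T : K →ₗ[ℂ] (Fin 3 → ℂ) := LinearMap.funLeft ℂ ℂ ![4, 5, 11] ∘ₗ K.subtype
  have hinj : Function.Injective T := by
    rw [← LinearMap.ker_eq_bot, LinearMap.ker_eq_bot']
    rintro ⟨l, hl⟩ hT
    have h4 : l 4 = 0 := congrFun hT 0
    have h5 : l 5 = 0 := congrFun hT 1
    have h11 : l 11 = 0 := congrFun hT 2
    -- a column with exactly one value left unknown determines it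
    have step : ∀ (j : Fin 34) (i : Fin 12), i ∈ perlesCofacet j →
        (∀ k ∈ perlesCofacet j, k ≠ i → l k = 0) → l i = 0 := by
      intro j i hi hk
      have h0 := hK l hl j
      rw [Finset.sum_eq_single_of_mem i hi fun k hkj hki => by rw [hk k hkj hki, mul_zero]] at h0
      exact (mul_eq_zero.1 h0).resolve_left ((hM i j).2 hi)
    have h8 : l 8 = 0 := step 0 8 (by decide) (by simp [perlesCofacet, h5])
    have h2 : l 2 = 0 := step 10 2 (by decide) (by simp [perlesCofacet, h5, h11])
    have h3 : l 3 = 0 := step 11 3 (by decide) (by simp [perlesCofacet, h4, h11])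
    have h1 : l 1 = 0 := step 7 1 (by decide) (by simp [perlesCofacet, h4, h8])
    have h0 : l 0 = 0 := step 3 0 (by decide) (by simp [perlesCofacet, h1, h8])
    have h7 : l 7 = 0 := step 5 7 (by decide) (by simp [perlesCofacet, h0, h11])
    have h6 : l 6 = 0 := step 8 6 (by decide) (by simp [perlesCofacet, h1, h11])
    have h9 : l 9 = 0 := step 1 9 (by decide) (by simp [perlesCofacet, h6])
    have h10 : l 10 = 0 := step 2 10 (by decide) (by simp [perlesCofacet, h7])
    ext i
    fin_cases i <;> assumption
  have hle := LinearMap.finrank_le_finrank_of_injective hinj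
  rw [Module.finrank_fin_fun] at hle
  obtain ⟨l, hl⟩ := (LinearMap.injective_iff_surjective_of_finrank_eq_finrank
    (by rw [Module.finrank_fin_fun]; omega)).1 hinj x
  exact ⟨l.1, hK _ l.2, congrFun hl 0, congrFun hl 1, congrFun hl 2⟩

/-- The incidences of the first thirteen columns force the relation: in the basis `E`, `F`, `-I` of
the space of the twelve vectors given by the left kernel, the vectors `A`, `B` have third coordinate zero,
`C` has first and `D` has second coordinate zero, and the points `G` and `H` each lie on three
lines. -/
theorem perles_relation {M : Matrix (Fin 12) (Fin 34) ℂ}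
    (hM : ∀ i j, M i j ≠ 0 ↔ i ∈ perlesCofacet j) (hrank : M.rank ≤ 9) :
    (M 2 10 * M 4 9 * M 11 11) ^ 2 + (M 2 10 * M 4 9 * M 11 11) * (M 2 9 * M 4 11 * M 11 10)
      - (M 2 9 * M 4 11 * M 11 10) ^ 2 = 0 := by
  have ne : ∀ i j, i ∈ perlesCofacet j → M i j ≠ 0 := fun i j => (hM i j).2
  -- the coordinates of the vectors with respect to the basis, first those of `E`, `F`, `-I`
  obtain ⟨u, hu, hu4, hu5, hu11⟩ := exists_leftKernel_vector hM hrank ![1, 0, 0]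
  obtain ⟨v, hv, hv4, hv5, hv11⟩ := exists_leftKernel_vector hM hrank ![0, 1, 0]
  obtain ⟨z, hz, hz4, hz5, hz11⟩ := exists_leftKernel_vector hM hrank ![0, 0, 1]
  simp only [Matrix.cons_val_zero, Matrix.cons_val_one, Matrix.cons_val] at hu4 hu5 hu11
  simp only [Matrix.cons_val_zero, Matrix.cons_val_one, Matrix.cons_val] at hv4 hv5 hv11
  simp only [Matrix.cons_val_zero, Matrix.cons_val_one, Matrix.cons_val] at hz4 hz5 hz11
  have pair : ∀ {l : Fin 12 → ℂ}, (∀ j, ∑ i ∈ perlesCofacet j, M i j * l i = 0) →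
      ∀ {a b : Fin 12} (j : Fin 34), a ≠ b → perlesCofacet j = {a, b} →
      M a j * l a + M b j * l b = 0 := by
    intro l hl a b j hab hj
    have := hl j
    rwa [hj, Finset.sum_pair hab] at this
  have triple : ∀ {l : Fin 12 → ℂ}, (∀ j, ∑ i ∈ perlesCofacet j, M i j * l i = 0) →
      ∀ {a b c : Fin 12} (j : Fin 34), a ≠ b → a ≠ c → b ≠ c → perlesCofacet j = {a, b, c} →
      M a j * l a + M b j * l b + M c j * l c = 0 := by
    intro l hl a b c j hab hac hbc hj
    have := hl j
    rwa [hj, Finset.sum_insert (by simp [hab, hac]), Finset.sum_pair hbc, ← add_assoc] at this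
  have rels : ∀ {l : Fin 12 → ℂ}, (∀ j, ∑ i ∈ perlesCofacet j, M i j * l i = 0) →
      (M 5 0 * l 5 + M 8 0 * l 8 = 0) ∧
      (M 6 1 * l 6 + M 9 1 * l 9 = 0) ∧
      (M 7 2 * l 7 + M 10 2 * l 10 = 0) ∧
      (M 0 3 * l 0 + M 1 3 * l 1 + M 8 3 * l 8 = 0) ∧
      (M 0 4 * l 0 + M 3 4 * l 3 + M 9 4 * l 9 = 0) ∧
      (M 0 5 * l 0 + M 7 5 * l 7 + M 11 5 * l 11 = 0) ∧
      (M 1 6 * l 1 + M 2 6 * l 2 + M 10 6 * l 10 = 0) ∧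
      (M 1 7 * l 1 + M 4 7 * l 4 + M 8 7 * l 8 = 0) ∧
      (M 1 8 * l 1 + M 6 8 * l 6 + M 11 8 * l 11 = 0) ∧
      (M 2 9 * l 2 + M 4 9 * l 4 + M 9 9 * l 9 = 0) ∧
      (M 2 10 * l 2 + M 5 10 * l 5 + M 11 10 * l 11 = 0) ∧
      (M 3 11 * l 3 + M 4 11 * l 4 + M 11 11 * l 11 = 0) ∧
      (M 3 12 * l 3 + M 5 12 * l 5 + M 10 12 * l 10 = 0) :=
    fun hl => ⟨pair hl 0 (by decide) rfl,
      pair hl 1 (by decide) rfl,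
      pair hl 2 (by decide) rfl,
      triple hl 3 (by decide) (by decide) (by decide) rfl,
      triple hl 4 (by decide) (by decide) (by decide) rfl,
      triple hl 5 (by decide) (by decide) (by decide) rfl,
      triple hl 6 (by decide) (by decide) (by decide) rfl,
      triple hl 7 (by decide) (by decide) (by decide) rfl,
      triple hl 8 (by decide) (by decide) (by decide) rfl,
      triple hl 9 (by decide) (by decide) (by decide) rfl,
      triple hl 10 (by decide) (by decide) (by decide) rfl,
      triple hl 11 (by decide) (by decide) (by decide) rfl,
      triple hl 12 (by decide) (by decide) (by decide) rfl⟩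
  obtain ⟨-, u_1, u_2, -, u_4, u_5, u_6, -, u_8, u_9, u_10, u_11, u_12⟩ := rels hu
  obtain ⟨v_0, v_1, v_2, -, v_4, v_5, v_6, v_7, v_8, v_9, v_10, v_11, v_12⟩ := rels hv
  obtain ⟨z_0, -, -, z_3, z_4, -, z_6, z_7, -, z_9, z_10, z_11, z_12⟩ := rels hz
  rw [hu5] at u_10 u_12
  rw [hu11] at u_5 u_8 u_10 u_11
  rw [hu4] at u_9 u_11
  rw [hv5] at v_0 v_10 v_12
  rw [hv11] at v_5 v_8 v_10 v_11
  rw [hv4] at v_7 v_9 v_11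
  rw [hz5] at z_0 z_10 z_12
  rw [hz11] at z_10 z_11
  rw [hz4] at z_7 z_9 z_11
  have cancel : ∀ {a b : ℂ}, a ≠ 0 → a * b = 0 → b = 0 := fun ha h =>
    (mul_eq_zero.1 h).resolve_left ha
  have z8 : z 8 = 0 := cancel (ne 8 0 (by decide)) (by linear_combination z_0)
  have z1 : z 1 = 0 := cancel (ne 1 7 (by decide)) (by linear_combination z_7 - M 8 7 * z8)
  have z0 : z 0 = 0 := cancel (ne 0 3 (by decide))
    (by linear_combination z_3 - M 8 3 * z8 - M 1 3 * z1)
  have u2 : u 2 = 0 := cancel (ne 2 10 (by decide)) (by linear_combination u_10)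
  have v3 : v 3 = 0 := cancel (ne 3 11 (by decide)) (by linear_combination v_11)
  have v8 : v 8 ≠ 0 := fun h => ne 5 0 (by decide) (by linear_combination v_0 - M 8 0 * h)
  have v1 : v 1 ≠ 0 := fun h => mul_ne_zero (ne 8 7 (by decide)) v8
    (by linear_combination v_7 - M 1 7 * h)
  have v2 : v 2 ≠ 0 := fun h => ne 5 10 (by decide) (by linear_combination v_10 - M 2 10 * h)
  have u3 : u 3 ≠ 0 := fun h => ne 4 11 (by decide) (by linear_combination u_11 - M 3 11 * h)
  have v9 : v 9 ≠ 0 := fun h => mul_ne_zero (ne 2 9 (by decide)) v2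
    (by linear_combination v_9 - M 9 9 * h)
  have v0 : v 0 ≠ 0 := fun h => mul_ne_zero (ne 9 4 (by decide)) v9
    (by linear_combination v_4 - M 0 4 * h - M 3 4 * v3)
  have u10 : u 10 ≠ 0 := fun h => mul_ne_zero (ne 3 12 (by decide)) u3
    (by linear_combination u_12 - M 10 12 * h)
  -- `G` lies on the lines `BI` and `CE`
  have hG6 : u 6 * v 1 - v 6 * u 1 = 0 := cancel (ne 6 8 (by decide))
    (by linear_combination v 1 * u_8 - u 1 * v_8)
  have hG9 : u 9 * v 1 - v 9 * u 1 = 0 := cancel (ne 9 1 (by decide))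
    (by linear_combination v 1 * u_1 - u 1 * v_1 - M 6 1 * hG6)
  have hG : M 4 9 * v 1 = M 2 9 * v 2 * u 1 := by
    linear_combination v 1 * u_9 - u 1 * v_9 - M 9 9 * hG9 - M 2 9 * v 1 * u2
  -- `G` lies on the line `AD`
  have hdet : u 0 * z 3 * v 9 - v 0 * (z 3 * u 9 - u 3 * z 9) = 0 := cancel (ne 0 4 (by decide))
    (by linear_combination z 3 * v 9 * u_4 - (z 3 * u 9 - u 3 * z 9) * v_4 - u 3 * v 9 * z_4
          + (z 3 * u 9 - u 3 * z 9) * M 3 4 * v3 + u 3 * v 9 * M 0 4 * z0)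
  have hAD : u 0 * (v 2 * z 3 * v 1) - v 0 * (v 2 * u 1 * z 3 - z 2 * u 3 * v 1) = 0 :=
    cancel (ne 2 9 (by decide)) (by
      linear_combination -(M 9 9 * v 1) * hdet + u 0 * z 3 * v 1 * v_9
        - v 0 * z 3 * (v 1 * u_9 - hG - M 2 9 * v 1 * u2) + v 0 * u 3 * v 1 * z_9)
  -- `H` lies on the lines `AI` and `DF`
  have hH7 : u 0 * v 7 - u 7 * v 0 = 0 := cancel (ne 7 5 (by decide))
    (by linear_combination u 0 * v_5 - v 0 * u_5)
  have hH10 : u 0 * v 10 - u 10 * v 0 = 0 := cancel (ne 10 2 (by decide))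
    (by linear_combination u 0 * v_2 - v 0 * u_2 - M 7 2 * hH7)
  have hDF : u 10 * z 3 - z 10 * u 3 = 0 := cancel (ne 10 12 (by decide))
    (by linear_combination z 3 * u_12 - u 3 * z_12)
  -- `H` lies on the line `BC`
  have hBC : u 1 * v 2 * z 10 + v 1 * z 2 * u 10 - u 1 * z 2 * v 10 = 0 :=
    cancel (ne 10 6 (by decide)) (by
      linear_combination u 1 * v 2 * z_6 + v 1 * z 2 * u_6 - u 1 * z 2 * v_6
        - u 1 * v 2 * M 1 6 * z1 - v 1 * z 2 * M 2 6 * u2)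
  have hH : u 0 * (v 2 * u 1 * z 3 + z 2 * u 3 * v 1) - v 0 * (u 3 * u 1 * z 2) = 0 :=
    cancel u10 (by
      linear_combination u 0 * u 3 * hBC + u 0 * u 1 * v 2 * hDF + u 1 * z 2 * u 3 * hH10)
  have hPQ : (v 2 * u 1 * z 3) ^ 2 - (v 2 * u 1 * z 3) * (z 2 * u 3 * v 1)
      - (z 2 * u 3 * v 1) ^ 2 = 0 := cancel v0 (by
    linear_combination (v 2 * z 3 * v 1) * hH - (v 2 * u 1 * z 3 + z 2 * u 3 * v 1) * hAD)
  have hX : M 2 10 * M 4 9 * M 11 11 * v 1 = -(M 2 10 * M 2 9 * M 3 11) * (v 2 * u 1 * z 3) := by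
    linear_combination M 2 10 * M 11 11 * hG + M 2 10 * M 2 9 * v 2 * u 1 * z_11
  have hY : M 2 9 * M 4 11 * M 11 10 * v 1 = M 2 10 * M 2 9 * M 3 11 * (z 2 * u 3 * v 1) := by
    linear_combination M 2 9 * M 11 10 * v 1 * u_11 - M 2 9 * M 3 11 * u 3 * v 1 * z_10
  refine cancel (pow_ne_zero 2 v1) ?_
  rw [mul_sub, mul_add, ← mul_pow, ← mul_pow]
  have hX' : v 1 * (M 2 10 * M 4 9 * M 11 11) =
      -(M 2 10 * M 2 9 * M 3 11) * (v 2 * u 1 * z 3) := by rw [← hX, mul_comm]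
  have hY' : v 1 * (M 2 9 * M 4 11 * M 11 10) =
      M 2 10 * M 2 9 * M 3 11 * (z 2 * u 3 * v 1) := by rw [← hY, mul_comm]
  have hXY : v 1 ^ 2 * (M 2 10 * M 4 9 * M 11 11 * (M 2 9 * M 4 11 * M 11 10)) =
      (v 1 * (M 2 10 * M 4 9 * M 11 11)) * (v 1 * (M 2 9 * M 4 11 * M 11 10)) := by ring
  rw [hXY, hX', hY']
  linear_combination (M 2 10 * M 2 9 * M 3 11) ^ 2 * hPQ

/-! ### Points of slack varieties -/

section SlackVariety

variable {v f d : ℕ} {S : Matrix (Fin v) (Fin f) ℝ}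

open Classical in
theorem eval_symbolicSlackMatrix (s : SlackVar S → ℂ) (i : Fin v) (j : Fin f) :
    eval s (symbolicSlackMatrix S i j) = if h : S i j ≠ 0 then s ⟨(i, j), h⟩ else 0 := by
  simp only [symbolicSlackMatrix, Matrix.of_apply]
  split_ifs <;> simp

theorem mem_zeroLocus_minorIdeal_iff (s : SlackVar S → ℂ) :
    s ∈ zeroLocus ℂ (minorIdeal (d + 2) (symbolicSlackMatrix S)) ↔
      ((symbolicSlackMatrix S).map (eval s)).rank ≤ d + 1 := by
  rw [minorIdeal, zeroLocus_span, Matrix.rank_le_iff_forall_minor_eq_zero]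
  have hdet : ∀ (r : Fin (d + 2) ↪o Fin v) (c : Fin (d + 2) ↪o Fin f),
      eval s ((symbolicSlackMatrix S).submatrix r c).det =
        (((symbolicSlackMatrix S).map (eval s)).submatrix r c).det := by
    intro r c
    rw [RingHom.map_det, RingHom.mapMatrix_apply, Matrix.submatrix_map]
  constructor
  · intro h r c
    rw [← hdet]
    exact h _ ⟨r, c, rfl⟩
  · rintro h _ ⟨r, c, rfl⟩
    have := h r c
    rwa [← hdet] at this

/-- A filling of the symbolic slack matrix by nonzero numbers that has rank at most `d + 1` is a
point of the slack variety. -/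
theorem mem_slackVariety_of_rank_le {s : SlackVar S → ℂ} (hs : ∀ e, s e ≠ 0)
    (hrank : ((symbolicSlackMatrix S).map (eval s)).rank ≤ d + 1) : s ∈ slackVariety d S := by
  rw [slackVariety, mem_zeroLocus_iff]
  rintro q ⟨n, hn⟩
  have h := (mem_zeroLocus_iff.1 ((mem_zeroLocus_minorIdeal_iff s).2 hrank)) _ hn
  rw [map_mul, map_pow, map_prod, mul_eq_zero] at h
  refine h.resolve_left (pow_ne_zero _ (Finset.prod_ne_zero_iff.2 fun e _ => ?_))
  simpa using hs e

/-- By the Nullstellensatz, a polynomial that vanishes on all fillings of the symbolic slack matrix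
by nonzero numbers that have rank at most `d + 1` has a power in the slack ideal. -/
theorem exists_pow_mem_slackIdeal {q : MvPolynomial (SlackVar S) ℂ}
    (hq : ∀ s : SlackVar S → ℂ, (∀ e, s e ≠ 0) →
      ((symbolicSlackMatrix S).map (eval s)).rank ≤ d + 1 → eval s q = 0) :
    ∃ n, q ^ n ∈ slackIdeal d S := by
  have hmem : (∏ e : SlackVar S, X e) * q ∈
      vanishingIdeal ℂ (zeroLocus ℂ (minorIdeal (d + 2) (symbolicSlackMatrix S))) := by
    rw [mem_vanishingIdeal_iff]
    intro s hs
    rw [map_mul, map_prod, mul_eq_zero]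
    by_cases h : ∃ e, s e = 0
    · obtain ⟨e, he⟩ := h
      exact Or.inl (Finset.prod_eq_zero (Finset.mem_univ e) (by simpa using he))
    · push Not at h
      exact Or.inr (hq s h ((mem_zeroLocus_minorIdeal_iff s).1 hs))
  rw [vanishingIdeal_zeroLocus_eq_radical] at hmem
  obtain ⟨n, hn⟩ := hmem
  rw [mul_pow] at hn
  exact ⟨n, n, hn⟩

theorem not_isPrime_slackIdeal {q q₁ q₂ : MvPolynomial (SlackVar S) ℂ} (hq : q = q₁ * q₂)
    (hpow : ∃ n, q ^ n ∈ slackIdeal d S) (h₁ : ∃ s ∈ slackVariety d S, eval s q₁ ≠ 0)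
    (h₂ : ∃ s ∈ slackVariety d S, eval s q₂ ≠ 0) : ¬ (slackIdeal d S).IsPrime := by
  intro hprime
  obtain ⟨n, hn⟩ := hpow
  obtain ⟨s₁, hs₁, hne₁⟩ := h₁
  obtain ⟨s₂, hs₂, hne₂⟩ := h₂
  have hmem := hprime.mem_of_pow_mem n hn
  rw [hq] at hmem
  rcases hprime.mem_or_mem hmem with h | h
  · exact hne₁ (mem_zeroLocus_iff.1 hs₁ _ h)
  · exact hne₂ (mem_zeroLocus_iff.1 hs₂ _ h)

theorem not_isPrime_vanishingIdeal {σ : Type*} {V : Set (σ → ℂ)} {q q₁ q₂ : MvPolynomial σ ℂ}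
    (hq : q = q₁ * q₂) (hV : ∀ s ∈ V, eval s q = 0) (h₁ : ∃ s ∈ V, eval s q₁ ≠ 0)
    (h₂ : ∃ s ∈ V, eval s q₂ ≠ 0) : ¬ (vanishingIdeal ℂ V).IsPrime := by
  intro hprime
  obtain ⟨s₁, hs₁, hne₁⟩ := h₁
  obtain ⟨s₂, hs₂, hne₂⟩ := h₂
  have hmem : q ∈ vanishingIdeal ℂ V := mem_vanishingIdeal_iff.2 hV
  rw [hq] at hmem
  rcases hprime.mem_or_mem hmem with h | h
  · exact hne₁ (mem_vanishingIdeal_iff.1 h _ hs₁)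
  · exact hne₂ (mem_vanishingIdeal_iff.1 h _ hs₂)

/-- The point given by the circuits over `ℤ[√5]`, for either square root of five. -/
theorem exists_mem_slackVariety_perles {σ : Fin 12 ≃ Fin v} {τ : Fin 34 ≃ Fin f}
    (hS : ∀ i j, S (σ i) (τ j) ≠ 0 ↔ i ∈ perlesCofacet j) {r : ℂ} (hr : r * r = 5) :
    ∃ s ∈ slackVariety 8 S, ∀ i j,
      eval s (symbolicSlackMatrix S (σ i) (τ j)) = sqrtFiveHom r hr (perlesSlackInt i j) := by
  let s : SlackVar S → ℂ := fun e =>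
    sqrtFiveHom r hr (perlesSlackInt (σ.symm e.1.1) (τ.symm e.1.2))
  have hs : ∀ i j,
      eval s (symbolicSlackMatrix S (σ i) (τ j)) = sqrtFiveHom r hr (perlesSlackInt i j) := by
    intro i j
    rw [eval_symbolicSlackMatrix]
    split_ifs with h
    · simp [s]
    · rw [hS, ← sqrtFiveHom_perlesSlackInt_ne_zero_iff hr, not_not] at h
      exact h.symm
  refine ⟨s, mem_slackVariety_of_rank_le (fun e => ?_) ?_, hs⟩
  · refine (sqrtFiveHom_perlesSlackInt_ne_zero_iff hr _ _).2 ((hS _ _).1 ?_)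
    simpa using e.2
  · rw [← Matrix.rank_submatrix _ σ τ]
    have : ((symbolicSlackMatrix S).map (eval s)).submatrix σ τ =
        perlesSlackInt.map (sqrtFiveHom r hr) := by
      ext i j
      exact hs i j
    rw [this]
    exact rank_perlesSlackInt_map_le hr

theorem perles_relation_eval {σ : Fin 12 ≃ Fin v} {τ : Fin 34 ≃ Fin f}
    (hS : ∀ i j, S (σ i) (τ j) ≠ 0 ↔ i ∈ perlesCofacet j) {s : SlackVar S → ℂ}
    (hs : ∀ e, s e ≠ 0) (hrank : ((symbolicSlackMatrix S).map (eval s)).rank ≤ 9) :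
    let M : Fin 12 → Fin 34 → ℂ := fun i j => eval s (symbolicSlackMatrix S (σ i) (τ j))
    (M 2 10 * M 4 9 * M 11 11) ^ 2 + (M 2 10 * M 4 9 * M 11 11) * (M 2 9 * M 4 11 * M 11 10)
      - (M 2 9 * M 4 11 * M 11 10) ^ 2 = 0 := by
  refine perles_relation (M := ((symbolicSlackMatrix S).map (eval s)).submatrix σ τ) ?_ ?_
  · intro i j
    rw [← hS, Matrix.submatrix_apply, Matrix.map_apply, eval_symbolicSlackMatrix]
    by_cases h : S (σ i) (τ j) ≠ 0
    · simp [h, hs]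
    · simp [h]
  · rwa [Matrix.rank_submatrix]

end SlackVariety
/-! ### The slack ideal of the Perles polytope is not prime -/

theorem mainTheorem3 :
    -- the Perles Gale diagram is the Gale diagram of a point configuration in dimension eight
    (∃ p : Fin 12 → Fin 8 → ℝ, HasGaleDiagram p perlesGale) ∧
    ∀ p : Fin 12 → Fin 8 → ℝ, HasGaleDiagram p perlesGale →
      -- the points are the 12 vertices of an 8-polytope with 34 facets and the displayed support
      ∃ (W : Matrix (Fin 34) (Fin 8) ℝ) (w : Fin 34 → ℝ), IsLabelledPolytope p W w ∧
        (∀ i j, slackMatrix p W w i j ≠ 0 ↔ i ∈ perlesCofacet j) ∧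
        -- every polytope `Q` (with any labelling) in the combinatorial class of this polytope
        ∀ (v f : ℕ) (q : Fin v → Fin 8 → ℝ) (U : Matrix (Fin f) (Fin 8) ℝ) (u : Fin f → ℝ),
          IsLabelledPolytope q U u →
          ∀ (σ : Fin 12 ≃ Fin v) (τ : Fin 34 ≃ Fin f),
            (∀ i j, slackMatrix q U u (σ i) (τ j) = 0 ↔ slackMatrix p W w i j = 0) →
            let S := slackMatrix q U u
            let y : Fin 12 → Fin 34 → MvPolynomial (SlackVar S) ℂ :=
              fun i j => symbolicSlackMatrix S (σ i) (τ j)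
            let x₉ := y 2 9
            let x₁₀ := y 2 10
            let x₁₅ := y 4 9
            let x₁₆ := y 4 11
            let x₃₅ := y 11 10
            let x₃₆ := y 11 11
            let F := (x₁₀ * x₁₅ * x₃₆) ^ 2 + (x₁₀ * x₁₅ * x₃₆) * (x₉ * x₁₆ * x₃₅)
              - (x₉ * x₁₆ * x₃₅) ^ 2
            let F₁ := x₁₀ * x₁₅ * x₃₆ - C (((-1 + √5) / 2 : ℝ) : ℂ) * (x₉ * x₁₆ * x₃₅)
            let F₂ := x₁₀ * x₁₅ * x₃₆ - C (((-1 - √5) / 2 : ℝ) : ℂ) * (x₉ * x₁₆ * x₃₅)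
            ¬ (slackIdeal 8 S).IsPrime ∧
            ¬ (vanishingIdeal ℂ (slackVariety 8 S)).IsPrime ∧
            F = F₁ * F₂ ∧
            (∀ s ∈ slackVariety 8 S, eval s F = 0) ∧
            (∃ s ∈ slackVariety 8 S, eval s F₁ ≠ 0) ∧
            (∃ s ∈ slackVariety 8 S, eval s F₂ ≠ 0) := by
  refine ⟨exists_hasGaleDiagram_perlesGale, fun p hp => ?_⟩
  obtain ⟨W, w, hpoly, hsupp⟩ := exists_isLabelledPolytope_of_perlesGale hp
  refine ⟨W, w, hpoly, hsupp, ?_⟩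
  intro v f q U u _ σ τ hστ S y x₉ x₁₀ x₁₅ x₁₆ x₃₅ x₃₆ F F₁ F₂
  have hS : ∀ i j, S (σ i) (τ j) ≠ 0 ↔ i ∈ perlesCofacet j := fun i j => by
    rw [← hsupp, not_iff_not]
    exact hστ i j
  have hFF : F = F₁ * F₂ := by
    have hsum : C (((-1 + √5) / 2 : ℝ) : ℂ) + C (((-1 - √5) / 2 : ℝ) : ℂ) =
        (-1 : MvPolynomial (SlackVar S) ℂ) := by
      rw [← map_add, ← Complex.ofReal_add, show (-1 + √5) / 2 + (-1 - √5) / 2 = -1 by ring]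
      simp
    have hprod : C (((-1 + √5) / 2 : ℝ) : ℂ) * C (((-1 - √5) / 2 : ℝ) : ℂ) =
        (-1 : MvPolynomial (SlackVar S) ℂ) := by
      rw [← map_mul, ← Complex.ofReal_mul,
        show (-1 + √5) / 2 * ((-1 - √5) / 2) = -1 by linear_combination -sqrt_five_mul_self / 4]
      simp
    simp only [F, F₁, F₂]
    linear_combination (x₁₀ * x₁₅ * x₃₆) * (x₉ * x₁₆ * x₃₅) * hsum - (x₉ * x₁₆ * x₃₅) ^ 2 * hprod
  have hpow : ∃ n, F ^ n ∈ slackIdeal 8 S := by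
    refine exists_pow_mem_slackIdeal fun s hs hrank => ?_
    have := perles_relation_eval hS hs hrank
    simpa only [F, x₉, x₁₀, x₁₅, x₁₆, x₃₅, x₃₆, y, map_sub, map_add, map_mul, map_pow] using this
  have hvan : ∀ s ∈ slackVariety 8 S, eval s F = 0 := by
    intro s hs
    obtain ⟨n, hn⟩ := hpow
    have h := mem_zeroLocus_iff.1 hs _ hn
    rw [map_pow] at h
    exact eq_zero_of_pow_eq_zero h
  -- at the point of the square root `r`, the quotient of the two monomials is `(r - 1) / 2`
  have hne : ∀ r : ℂ, r * r = 5 → ∃ s ∈ slackVariety 8 S,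
      eval s (x₁₀ * x₁₅ * x₃₆ - C ((-1 - r) / 2) * (x₉ * x₁₆ * x₃₅)) ≠ 0 := by
    intro r hr
    obtain ⟨s, hs, hval⟩ := exists_mem_slackVariety_perles hS hr
    refine ⟨s, hs, ?_⟩
    have h9 : perlesSlackInt 2 9 = ⟨-1, 1⟩ := by decide +kernel
    have h10 : perlesSlackInt 2 10 = ⟨0, 2⟩ := by decide +kernel
    have h15 : perlesSlackInt 4 9 = ⟨2, 0⟩ := by decide +kernel
    have h16 : perlesSlackInt 4 11 = ⟨5, 3⟩ := by decide +kernel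
    have h35 : perlesSlackInt 11 10 = ⟨1, 1⟩ := by decide +kernel
    have h36 : perlesSlackInt 11 11 = ⟨1, 1⟩ := by decide +kernel
    have h : eval s (x₁₀ * x₁₅ * x₃₆ - C ((-1 - r) / 2) * (x₉ * x₁₆ * x₃₅)) =
        10 * (1 + r) ^ 2 := by
      simp only [x₉, x₁₀, x₁₅, x₁₆, x₃₅, x₃₆, y, map_sub, map_mul, eval_C, hval, h9, h10, h15,
        h16, h35, h36, sqrtFiveHom_apply]
      push_cast
      linear_combination ((1 + r) ^ 2 * (3 / 2) + (1 + r)) * hr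
    rw [h]
    refine mul_ne_zero (by norm_num) (pow_ne_zero _ fun h0 => ?_)
    have h1 : (4 : ℂ) = 0 := by linear_combination (r - 1) * h0 - hr
    norm_num at h1
  have hr : (√5 : ℂ) * (√5 : ℂ) = 5 := by
    rw [← Complex.ofReal_mul, sqrt_five_mul_self]
    norm_num
  have h₁ : ∃ s ∈ slackVariety 8 S, eval s F₁ ≠ 0 := by
    have h := hne (-(√5 : ℂ)) (by rw [neg_mul_neg]; exact hr)
    have e : (((-1 + √5) / 2 : ℝ) : ℂ) = (-1 - -(√5 : ℂ)) / 2 := by push_cast; ring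
    simp only [F₁, e]
    exact h
  have h₂ : ∃ s ∈ slackVariety 8 S, eval s F₂ ≠ 0 := by
    have h := hne (√5 : ℂ) hr
    have e : (((-1 - √5) / 2 : ℝ) : ℂ) = (-1 - (√5 : ℂ)) / 2 := by push_cast; ring
    simp only [F₂, e]
    exact h
  exact ⟨not_isPrime_slackIdeal hFF hpow h₁ h₂, not_isPrime_vanishingIdeal hFF hvan h₁ h₂,
    hFF, hvan, h₁, h₂⟩
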